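/- All logarithms are to base $2$. Let $\mathcal X$ be a finite set, $\mathcal Y$ a measurable space, and $\boldsymbol W=\{W_x\}_{x\in\mathcal X}$ a family of probability measures on $\mathcal Y$ (a channel). Put $W_P:=\sum_x P(x)W_x$ for $P\in\mathcal P(\mathcal X)$, and $W^n_{x^n}:=W_{x_1}\times\dots\times W_{x_n}$ for $x^n\in\mathcal X^n$. For probability measures $P,Q$ let $D(P\|Q)$ be the Kullback–Leibler divergence and, for $\alpha>1$, $D_\alpha(P\|Q):=\frac1{\alpha-1}\log \mathbb E_P\big[(\tfrac{dP}{dQ})^{\alpha-1}\big]$ the Rényi divergence (both are $\infty$ unless $P\ll Q$). Let $$H(X)_P:=-\sum_x P(x)\log P(x),\qquad I(X;Y)_P:=\sum_x P(x)D(W_x\|W_P),\qquad I_\alpha(X;Y)_P:=\min_{Q\in\mathcal P(\mathcal Y)}D_\alpha(\boldsymbol W\times P\|Q\times P),$$ where $\boldsymbol W\times P$ is the joint law of an input $x$ of law $P$ and an output of law $W_x$, and $Q\times P$ is the product law. A deterministic code of length $n$ consists of integers $1\le \mathsf L<\mathsf M$, an encoder $\phi:\{1,\dots,\mathsf M\}\to\mathcal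 X^n$, and a measurable list decoder $\Psi$ which assigns to each $y\in\mathcal Y^n$ a subset $\Psi(y)\subset\{1,\dots,\mathsf M\}$ with at most $\mathsf L$ elements. Set $$\epsilon_A:=\max_m W^n_{\phi(m)}\{y: m\notin\Psi(y)\},$$ $$\delta_D:=\max_{x^n\in\mathcal X^n}\Big(\text{the second largest, with multiplicity, of the numbers } W^n_{x^n}\{y: m\in\Psi(y)\},\ m=1,\dots,\mathsf M\Big),$$ $$E(\phi):=\log \mathsf M-\min_{Q\in\mathcal P(\mathcal Y^n)}\sum_{m}\tfrac1{\mathsf M}D(W^n_{\phi(m)}\|Q),$$ $$E_\alpha(\phi):=\log \mathsf M-\min_{Q\in\mathcal P(\mathcal Y^n)}\tfrac1{\alpha-1}\log\sum_m \tfrac1{\mathsf M}2^{(\alpha-1)D_\alpha(W^n_{\phi(m)}\|Q)} .$$ A triple $(R_1,R_2,R_3)$ of real numbers is strongly deterministically achievable (respectively $\alpha$-strongly deterministically achievable) if there is a sequence of deterministic codes, one for each length $n$, such that, as $n\to\infty$, $\epsilon_A\to0$, $\delta_D\to0$, $\frac1n\log\mathsf M\to R_1$, $\frac1n\log\mathsf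 L\to R_2$, and $\liminf_{n}\frac1nE(\phi_n)\ge R_3$ (respectively $\liminf_n\frac1nE_\alpha(\phi_n)\ge R_3$). **Theorem.** Assume the non-redundancy condition (W2): $$\min_{x\in\mathcal X}\ \min_{P\in\mathcal P(\mathcal X\setminus\{x\})}D\Big(\sum_{x'\ne x}P(x')W_{x'}\Big\|W_x\Big)>0 .$$ Let $R_1,R_2,R_3$ be real numbers with $R_2\ge0$. (i) $(R_1,R_2,R_3)$ is strongly deterministically achievable if there exists $P\in\mathcal P(\mathcal X)$ such that $$0<R_1-R_2<I(X;Y)_P,\qquad R_1<H(X)_P,\qquad R_3\le R_1-I(X;Y)_P .$$ (ii) For every $\alpha>1$, $(R_1,R_2,R_3)$ is $\alpha$-strongly deterministically achievable if there exists $P\in\mathcal P(\mathcal X)$ such that $$0<R_1-R_2<I(X;Y)_P,\qquad R_1<H(X)_P,\qquad R_3\le R_1-I_\alpha(X;Y)_P .$$ -/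

import Mathlib

open MeasureTheory Filter Topology
open scoped ENNReal

namespace SecureListDecoding

noncomputable section

/-! Logarithms are to base `2`. Information quantities live in `ℝ≥0∞` or `EReal`, so that an
infinite value is never replaced by a default one. -/

/-- The base-2 logarithm `[0, ∞] → [-∞, ∞]`. -/
def log2 (a : ℝ≥0∞) : EReal := ENNReal.log a / ((Real.log 2 : ℝ) : EReal)

section Divergences

variable {Ω : Type*} [MeasurableSpace Ω]

/-- Kullback-Leibler divergence `D(P‖Q) = E_P[log (p/q)]` in bits, `∞` if `P` is not absolutely
continuous with respect to `Q`. Used for probability measures only. -/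
def klDiv2 (P Q : Measure Ω) : ℝ≥0∞ :=
  InformationTheory.klDiv P Q / ENNReal.ofReal (Real.log 2)

open Classical in
/-- `E_P[(p/q)^(α-1)] = 2 ^ ((α-1) D_α(P‖Q))` for `α > 1`; it is `∞` if `P` is not absolutely
continuous with respect to `Q`. -/
def renyiMoment (α : ℝ) (P Q : Measure Ω) : ℝ≥0∞ :=
  if P ≪ Q then ∫⁻ y, (P.rnDeriv Q y) ^ (α - 1) ∂P else ∞

/-- Rényi divergence of order `α > 1`: `D_α(P‖Q) = (α-1)⁻¹ log E_P[(p/q)^(α-1)]`. -/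
def renyiDiv (α : ℝ) (P Q : Measure Ω) : EReal :=
  log2 (renyiMoment α P Q) / ((α - 1 : ℝ) : EReal)

end Divergences

section Channel

variable {X Y : Type*} [Fintype X] [MeasurableSpace Y]

/-- Output distribution `W_P = ∑ x, P(x) W_x`. -/
def outputLaw (W : X → Measure Y) (P : PMF X) : Measure Y := ∑ x, P x • W x

/-- Shannon entropy `H(X)_P` of the input, in bits. -/
def inputEntropy (P : PMF X) : ℝ := ∑ x, -((P x).toReal * Real.logb 2 (P x).toReal)

/-- Mutual information `I(X;Y)_P = ∑ x, P(x) D(W_x‖W_P)`, in bits. -/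
def mutualInfo (W : X → Measure Y) (P : PMF X) : ℝ≥0∞ :=
  ∑ x, P x * klDiv2 (W x) (outputLaw W P)

/-- Joint distribution on `X × Y` of an input of law `P` and an output of law `V x` given the
input `x`. A constant family `V` gives the product distribution. -/
def jointLaw [MeasurableSpace X] (P : PMF X) (V : X → Measure Y) : Measure (X × Y) :=
  ∑ x, P x • (Measure.dirac x).prod (V x)

/-- Rényi mutual information `I_α(X;Y)_P = min_Q D_α(W × P ‖ Q × P)`, over all probability
measures `Q` on the output space. -/
def renyiMutualInfo [MeasurableSpace X] (α : ℝ) (W : X → Measure Y) (P : PMF X) : EReal :=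
  ⨅ Q : ProbabilityMeasure Y,
    renyiDiv α (jointLaw P W) (jointLaw P (fun _ => (Q : Measure Y)))

/-- The non-redundancy condition: the minimum of `D(∑ x', P(x') W_x' ‖ W_x)` over all inputs
`x` and all distributions `P` on the other inputs is positive. -/
def NonRedundant (W : X → Measure Y) : Prop :=
  0 < ⨅ (x : X) (P : PMF X) (_ : P x = 0), klDiv2 (outputLaw W P) (W x)

end Channel

/-- Output law `W^n_{x^n}` of `n` independent uses of the channel. -/
def channelPow {X Y : Type*} [MeasurableSpace Y] (W : X → Measure Y) {n : ℕ} (x : Fin n → X) :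
    Measure (Fin n → Y) :=
  Measure.pi (fun i => W (x i))

/-- A deterministic code for secure list decoding over `n` uses of a channel: a deterministic
encoder of `M` messages, and a measurable decoder that lists at most `L` of them, where
`1 ≤ L < M`. -/
structure ListCode (X Y : Type*) [MeasurableSpace Y] (n : ℕ) where
  /-- the number `M` of messages -/
  M : ℕ
  /-- the list size `L` -/
  L : ℕ
  L_pos : 0 < L
  L_lt_M : L < M
  /-- the encoder -/
  enc : Fin M → (Fin n → X)
  /-- the list decoder -/
  dec : (Fin n → Y) → Finset (Fin M)
  card_dec_le : ∀ y, (dec y).card ≤ L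
  measurableSet_dec : ∀ m, MeasurableSet {y | m ∈ dec y}

namespace ListCode

variable {X Y : Type*} [MeasurableSpace Y] {n : ℕ}

/-- Probability that message `m` is on the list when the channel input is `x`. -/
def acceptProb (C : ListCode X Y n) (W : X → Measure Y) (m : Fin C.M) (x : Fin n → X) : ℝ≥0∞ :=
  channelPow W x {y | m ∈ C.dec y}

/-- Verifiability parameter `ε_A`: the largest probability, over the messages `m`, that `m` is not
on the list when the codeword of `m` is sent. -/
def epsA (C : ListCode X Y n) (W : X → Measure Y) : ℝ≥0∞ :=
  ⨆ m, (1 - C.acceptProb W m (C.enc m))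

/-- Binding parameter `δ_D` for a dishonest sender: the largest value, over all channel inputs `x`,
of the second largest (with multiplicity) among the acceptance probabilities of the messages. The
second largest member of a family is the largest minimum of two members with distinct indices. -/
def deltaD (C : ListCode X Y n) (W : X → Measure Y) : ℝ≥0∞ :=
  ⨆ (x : Fin n → X) (m : Fin C.M) (m' : Fin C.M) (_ : m ≠ m'),
    min (C.acceptProb W m x) (C.acceptProb W m' x)

/-- Equivocation `E = log M - min_Q (1/M) ∑ m, D(W^n_{enc m}‖Q)`, i.e. `H(M|Y)` for a uniformly
distributed message. -/
def equivocation (C : ListCode X Y n) (W : X → Measure Y) : EReal :=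
  ((Real.logb 2 C.M : ℝ) : EReal) -
    ((⨅ Q : ProbabilityMeasure (Fin n → Y),
      (∑ m, klDiv2 (channelPow W (C.enc m)) (Q : Measure (Fin n → Y))) / (C.M : ℝ≥0∞) : ℝ≥0∞) :
        EReal)

/-- Rényi equivocation
`E_α = log M - min_Q (α-1)⁻¹ log ((1/M) ∑ m, 2 ^ ((α-1) D_α(W^n_{enc m}‖Q)))`. -/
def renyiEquivocation (α : ℝ) (C : ListCode X Y n) (W : X → Measure Y) : EReal :=
  ((Real.logb 2 C.M : ℝ) : EReal) -
    ⨅ Q : ProbabilityMeasure (Fin n → Y),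
      log2 ((∑ m, renyiMoment α (channelPow W (C.enc m)) (Q : Measure (Fin n → Y))) /
        (C.M : ℝ≥0∞)) / ((α - 1 : ℝ) : EReal)

end ListCode

section Achievability

variable {X Y : Type*} [MeasurableSpace Y]

/-- A sequence of codes is strongly secure if `ε_A → 0` and `δ_D → 0`. -/
def StronglySecure (W : X → Measure Y) (C : ∀ n, ListCode X Y n) : Prop :=
  Tendsto (fun n => (C n).epsA W) atTop (𝓝 0) ∧ Tendsto (fun n => (C n).deltaD W) atTop (𝓝 0)

/-- The message rate tends to `R₁` and the list rate to `R₂`. -/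
def HasRates (C : ∀ n, ListCode X Y n) (R₁ R₂ : ℝ) : Prop :=
  Tendsto (fun n : ℕ => Real.logb 2 ((C n).M : ℝ) / (n : ℝ)) atTop (𝓝 R₁) ∧
  Tendsto (fun n : ℕ => Real.logb 2 ((C n).L : ℝ) / (n : ℝ)) atTop (𝓝 R₂)

/-- Strong deterministic achievability of `(R₁, R₂, R₃)`. -/
def StronglyDetAchievable (W : X → Measure Y) (R₁ R₂ R₃ : ℝ) : Prop :=
  ∃ C : ∀ n, ListCode X Y n, StronglySecure W C ∧ HasRates C R₁ R₂ ∧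
    (R₃ : EReal) ≤ liminf (fun n : ℕ => (C n).equivocation W / (n : EReal)) atTop

/-- `α`-strong deterministic achievability of `(R₁, R₂, R₃)`. -/
def RenyiStronglyDetAchievable (α : ℝ) (W : X → Measure Y) (R₁ R₂ R₃ : ℝ) : Prop :=
  ∃ C : ∀ n, ListCode X Y n, StronglySecure W C ∧ HasRates C R₁ R₂ ∧
    (R₃ : EReal) ≤ liminf (fun n : ℕ => (C n).renyiEquivocation α W / (n : EReal)) atTop

end Achievability

end

end SecureListDecoding

/-! The codes come from random coding with expurgation. Codewords are drawn i.i.d. from `P`, and a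
message enters the list when its codeword passes two tests against the output; the list is emptied
if more than `L` messages pass. The first test asks that the information density exceed roughly `n
I(X;Y)_P`. The codeword sent passes, while an independent one passes with probability about `2^(-n
I)`, so `R₁ - R₂ < I` makes a list overflow unlikely by Markov's inequality
(`thresholdCode_one_sub_acceptProb_le`).

The second test gives binding against every input word. By (W2) no `W x` is a mixture of the other
outputs, so Hahn-Banach yields bounded functions `ξ x` with mean zero under `W x` and mean at most
`-ζ` under every other output law (`NonRedundant.exists_test`). Hence a word far in Hamming distance
from a codeword fails that codeword's test. As `R₁ < H(X)_P`, typical random codewords can be kept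
pairwise at distance more than `ε n`, and then no input is close to two of them. `exists_listCode`
combines these estimates and `eventually_exists_listCode` supplies the constants.

All codewords kept are typical for `P`, and this alone controls the equivocation. With a product law
as candidate `Q`, divergences and Rényi moments tensorize, so each codeword contributes about `n I`,
respectively at most about `n D_α`, where Jensen's inequality passes to the joint law
(`le_equivocation`, `le_renyiEquivocation`). A diagonal choice finally lets all tolerances tend to
zero (`exists_secure_typical_codes`). -/

namespace SecureListDecoding

/-! ### Tensorization of densities and divergences, and Chebyshev bounds. -/

section ProductMeasures

variable {ι : Type*} [Fintype ι] {Ω : Type*} [MeasurableSpace Ω]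

open ProbabilityTheory in
theorem lintegral_pi_prod (μ : ι → Measure Ω) [∀ i, IsProbabilityMeasure (μ i)]
    (f : ι → Ω → ℝ≥0∞) (hf : ∀ i, Measurable (f i)) :
    ∫⁻ y, ∏ i, f i (y i) ∂Measure.pi μ = ∏ i, ∫⁻ y, f i y ∂μ i := by
  rw [lintegral_prod_eq_prod_lintegral_of_indepFun Finset.univ
    (fun i (y : ι → Ω) => f i (y i)) (iIndepFun_pi fun i => (hf i).aemeasurable)
    fun i => (hf i).comp (measurable_pi_apply i)]
  refine Finset.prod_congr rfl fun i _ => ?_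
  rw [← (measurePreserving_eval μ i).lintegral_comp (hf i)]

theorem pi_withDensity (μ : ι → Measure Ω) [∀ i, IsProbabilityMeasure (μ i)]
    (f : ι → Ω → ℝ≥0∞) (hf : ∀ i, Measurable (f i))
    [∀ i, IsProbabilityMeasure ((μ i).withDensity (f i))] :
    Measure.pi (fun i => (μ i).withDensity (f i)) =
      (Measure.pi μ).withDensity (fun y => ∏ i, f i (y i)) := by
  refine Measure.pi_eq fun s hs => ?_
  rw [withDensity_apply _ (MeasurableSet.univ_pi hs),
    ← lintegral_indicator (MeasurableSet.univ_pi hs)]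
  have h : ∀ y : ι → Ω, (Set.univ.pi s).indicator (fun y => ∏ i, f i (y i)) y
      = ∏ i, (s i).indicator (f i) (y i) := by
    intro y
    by_cases hy : y ∈ Set.univ.pi s
    · rw [Set.indicator_of_mem hy]
      exact Finset.prod_congr rfl fun i _ =>
        (Set.indicator_of_mem (hy i (Set.mem_univ i)) _).symm
    · rw [Set.indicator_of_notMem hy]
      simp only [Set.mem_univ_pi, not_forall] at hy
      obtain ⟨i, hi⟩ := hy
      exact (Finset.prod_eq_zero (Finset.mem_univ i) (Set.indicator_of_notMem hi _)).symm
  simp_rw [h]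
  rw [lintegral_pi_prod μ _ fun i => (hf i).indicator (hs i)]
  refine Finset.prod_congr rfl fun i _ => ?_
  rw [withDensity_apply _ (hs i), lintegral_indicator (hs i)]

variable {μ ν : ι → Measure Ω} [∀ i, IsProbabilityMeasure (μ i)] [∀ i, IsProbabilityMeasure (ν i)]

theorem pi_eq_withDensity (h : ∀ i, μ i ≪ ν i) :
    Measure.pi μ = (Measure.pi ν).withDensity (fun y => ∏ i, (μ i).rnDeriv (ν i) (y i)) := by
  have e : ∀ i, (ν i).withDensity ((μ i).rnDeriv (ν i)) = μ i := fun i =>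
    Measure.withDensity_rnDeriv_eq _ _ (h i)
  have : ∀ i, IsProbabilityMeasure ((ν i).withDensity ((μ i).rnDeriv (ν i))) := fun i => by
    rw [e i]; infer_instance
  rw [← pi_withDensity ν _ fun i => Measure.measurable_rnDeriv _ _]
  simp_rw [e]

theorem measurable_prod_eval {f : ι → Ω → ℝ≥0∞} (hf : ∀ i, Measurable (f i)) :
    Measurable fun y : ι → Ω => ∏ i, f i (y i) :=
  Finset.measurable_prod _ fun i _ => (hf i).comp (measurable_pi_apply i)

theorem pi_absolutelyContinuous (h : ∀ i, μ i ≪ ν i) : Measure.pi μ ≪ Measure.pi ν := by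
  rw [pi_eq_withDensity h]
  exact withDensity_absolutelyContinuous _ _

theorem rnDeriv_pi (h : ∀ i, μ i ≪ ν i) :
    (Measure.pi μ).rnDeriv (Measure.pi ν) =ᵐ[Measure.pi ν]
      fun y => ∏ i, (μ i).rnDeriv (ν i) (y i) := by
  conv_lhs => rw [pi_eq_withDensity h]
  exact Measure.rnDeriv_withDensity _
    (measurable_prod_eval fun i => Measure.measurable_rnDeriv _ _)

/-- The density of a product is the product of the densities, a power respects products, and
independence factors the integral. -/
theorem renyiMoment_pi (h : ∀ i, μ i ≪ ν i) {α : ℝ} (hα : 1 < α) :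
    renyiMoment α (Measure.pi μ) (Measure.pi ν) = ∏ i, renyiMoment α (μ i) (ν i) := by
  have hac := pi_absolutelyContinuous h
  rw [renyiMoment, if_pos hac]
  simp_rw [renyiMoment, if_pos (h _)]
  rw [← lintegral_pi_prod μ _ fun i => (Measure.measurable_rnDeriv _ _).pow_const _]
  refine lintegral_congr_ae ?_
  filter_upwards [hac.ae_le (rnDeriv_pi h)] with y hy
  rw [hy, ← ENNReal.prod_rpow_of_nonneg (by linarith)]

theorem ae_rnDeriv_pos_lt_top {P Q : Measure Ω} [IsProbabilityMeasure P] [IsProbabilityMeasure Q]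
    (h : P ≪ Q) : ∀ᵐ y ∂P, 0 < P.rnDeriv Q y ∧ P.rnDeriv Q y < ∞ := by
  filter_upwards [Measure.rnDeriv_pos h, h.ae_le (Measure.rnDeriv_lt_top P Q)] with y h1 h2
  exact ⟨h1, h2⟩

theorem ae_pi_eval {p : ι → Ω → Prop} (h : ∀ i, ∀ᵐ y ∂μ i, p i y) :
    ∀ᵐ y ∂Measure.pi μ, ∀ i, p i (y i) :=
  ae_all_iff.2 fun i => (measurePreserving_eval μ i).quasiMeasurePreserving.ae (h i)

theorem llr_pi (h : ∀ i, μ i ≪ ν i) :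
    llr (Measure.pi μ) (Measure.pi ν) =ᵐ[Measure.pi μ] fun y => ∑ i, llr (μ i) (ν i) (y i) := by
  filter_upwards [(pi_absolutelyContinuous h).ae_le (rnDeriv_pi h),
    ae_pi_eval fun i => ae_rnDeriv_pos_lt_top (h i)] with y hy hpos
  simp only [llr]
  rw [hy, ENNReal.toReal_prod, Real.log_prod]
  exact fun i _ => (ENNReal.toReal_pos (hpos i).1.ne' (hpos i).2.ne).ne'

/-- By `llr_pi` the log-likelihood ratio is a sum over coordinates. Finiteness of each term makes
the summands integrable, so that the integral splits. -/
theorem klDiv_pi (h : ∀ i, InformationTheory.klDiv (μ i) (ν i) ≠ ∞) :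
    InformationTheory.klDiv (Measure.pi μ) (Measure.pi ν) =
      ∑ i, InformationTheory.klDiv (μ i) (ν i) := by
  have hac : ∀ i, μ i ≪ ν i := fun i => (InformationTheory.klDiv_ne_top_iff.1 (h i)).1
  have hint : ∀ i, Integrable (llr (μ i) (ν i)) (μ i) :=
    fun i => (InformationTheory.klDiv_ne_top_iff.1 (h i)).2
  have hint' : ∀ i, Integrable (fun y : ι → Ω => llr (μ i) (ν i) (y i)) (Measure.pi μ) :=
    fun i => (measurePreserving_eval μ i).integrable_comp_of_integrable (hint i)
  have hI : Integrable (llr (Measure.pi μ) (Measure.pi ν)) (Measure.pi μ) :=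
    (integrable_finsetSum _ fun i _ => hint' i).congr (llr_pi hac).symm
  have hne := InformationTheory.klDiv_ne_top (pi_absolutelyContinuous hac) hI
  rw [← ENNReal.toReal_eq_toReal_iff' hne (ENNReal.sum_ne_top.2 fun i _ => h i),
    ENNReal.toReal_sum fun i _ => h i,
    InformationTheory.toReal_klDiv_of_measure_eq (pi_absolutelyContinuous hac) (by simp),
    integral_congr_ae (llr_pi hac), integral_finsetSum _ fun i _ => hint' i]
  refine Finset.sum_congr rfl fun i _ => ?_
  rw [InformationTheory.toReal_klDiv_of_measure_eq (hac i) (by simp)]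
  exact integral_comp_eval (μ := μ) (i := i) (hint i).aestronglyMeasurable

open ProbabilityTheory in
/-- Chebyshev's inequality for a sum of independent bounded variables. -/
theorem pi_sum_le_mean_sub (μ : ι → Measure Ω) [∀ i, IsProbabilityMeasure (μ i)]
    {h : ι → Ω → ℝ} (hm : ∀ i, Measurable (h i)) {B : ℝ} (hB : ∀ i y, |h i y| ≤ B)
    {s : ℝ} (hs : 0 < s) :
    Measure.pi μ {y | ∑ i, h i (y i) ≤ ∑ i, ∫ y, h i y ∂μ i - s} ≤
      ENNReal.ofReal (Fintype.card ι * B ^ 2 / s ^ 2) := by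
  have hL : ∀ i, MemLp (h i) 2 (μ i) := fun i =>
    MemLp.of_bound (hm i).aestronglyMeasurable B (ae_of_all _ (hB i))
  have hL' : ∀ i, MemLp (fun y : ι → Ω => h i (y i)) 2 (Measure.pi μ) := fun i =>
    (hL i).comp_measurePreserving (measurePreserving_eval μ i)
  have hL2 : MemLp (∑ i, fun y : ι → Ω => h i (y i)) 2 (Measure.pi μ) :=
    memLp_finsetSum' _ fun i _ => hL' i
  have hmean : ∫ y, (∑ i, fun y : ι → Ω => h i (y i)) y ∂Measure.pi μ
      = ∑ i, ∫ y, h i y ∂μ i := by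
    simp only [Finset.sum_apply]
    rw [integral_finsetSum _ fun i _ => (hL' i).integrable (by norm_num)]
    exact Finset.sum_congr rfl fun i _ =>
      integral_comp_eval (μ := μ) (i := i) (hm i).aestronglyMeasurable
  have hvar : Var[∑ i, fun y : ι → Ω => h i (y i); Measure.pi μ] ≤ Fintype.card ι * B ^ 2 := by
    rw [variance_sum_pi hL]
    calc ∑ i, Var[h i; μ i] ≤ ∑ _i : ι, B ^ 2 := Finset.sum_le_sum fun i _ => by
          have := variance_le_sq_of_bounded (μ := μ i) (a := -B) (b := B) (X := h i)
            (ae_of_all _ fun y => abs_le.1 (hB i y)) (hm i).aemeasurable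
          rwa [show ((B - -B) / 2) ^ 2 = B ^ 2 by ring] at this
      _ = _ := by simp
  calc _ ≤ Measure.pi μ {y | s ≤ |(∑ i, fun y : ι → Ω => h i (y i)) y
        - ∫ y, (∑ i, fun y : ι → Ω => h i (y i)) y ∂Measure.pi μ|} := by
        refine measure_mono fun y hy => ?_
        simp only [Set.mem_ofPred_eq] at hy ⊢
        rw [hmean, Finset.sum_apply]
        refine le_trans ?_ (neg_le_abs _)
        linarith
    _ ≤ _ := meas_ge_le_variance_div_sq hL2 hs
    _ ≤ _ := ENNReal.ofReal_le_ofReal (by gcongr)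

theorem pi_mean_add_le_sum (μ : ι → Measure Ω) [∀ i, IsProbabilityMeasure (μ i)]
    {h : ι → Ω → ℝ} (hm : ∀ i, Measurable (h i)) {B : ℝ} (hB : ∀ i y, |h i y| ≤ B)
    {s : ℝ} (hs : 0 < s) :
    Measure.pi μ {y | ∑ i, ∫ y, h i y ∂μ i + s ≤ ∑ i, h i (y i)} ≤
      ENNReal.ofReal (Fintype.card ι * B ^ 2 / s ^ 2) := by
  refine le_trans (measure_mono fun y hy => ?_)
    (pi_sum_le_mean_sub μ (h := fun i y => - h i y) (fun i => (hm i).neg)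
      (fun i y => by simpa using hB i y) hs)
  simp only [Set.mem_ofPred_eq, integral_neg, Finset.sum_neg_distrib] at hy ⊢
  linarith

end ProductMeasures

/-! ### Random selection with expurgation. -/

section RandomSelection

variable {S : Type*} [MeasurableSpace S]

open ProbabilityTheory in
theorem lintegral_pi_pair {N : ℕ} (ν : Measure S) [IsProbabilityMeasure ν] {f : S → S → ℝ≥0∞}
    (hf : Measurable (Function.uncurry f)) {i j : Fin N} (hij : i ≠ j) :
    ∫⁻ c, f (c i) (c j) ∂Measure.pi (fun _ : Fin N => ν) = ∫⁻ s, ∫⁻ t, f s t ∂ν ∂ν := by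
  have hind : IndepFun (fun c : Fin N → S => c i) (fun c => c j) (Measure.pi fun _ => ν) :=
    (iIndepFun_pi (X := fun _ : Fin N => (id : S → S)) fun _ => aemeasurable_id).indepFun hij
  have hmap : (Measure.pi fun _ : Fin N => ν).map (fun c => (c i, c j)) = ν.prod ν := by
    rw [(indepFun_iff_map_prod_eq_prod_map_map
      (measurable_pi_apply i).aemeasurable (measurable_pi_apply j).aemeasurable).1 hind]
    congr 1
    · exact (measurePreserving_eval (fun _ : Fin N => ν) i).map_eq
    · exact (measurePreserving_eval (fun _ : Fin N => ν) j).map_eq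
  have := lintegral_prod (μ := ν) (ν := ν) (Function.uncurry f) hf.aemeasurable
  rw [← hmap, lintegral_map hf ((measurable_pi_apply i).prodMk (measurable_pi_apply j))] at this
  exact this

open Finset in
/-- Random selection with expurgation: if the average cost of a random family of `2M` points is
small, there are `M` points each of which has small cost relative to the others. -/
theorem exists_selection (ν : Measure S) [IsProbabilityMeasure ν] {b : S → ℝ≥0∞}
    {a : S → S → ℝ≥0∞} (hb : Measurable b) (ha : Measurable (Function.uncurry a)) (M : ℕ)
    {η : ℝ≥0∞} (hη0 : η ≠ 0) (hη : η ≠ ∞)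
    (h : ∫⁻ s, b s ∂ν + (2 * M : ℕ) * ∫⁻ s, ∫⁻ t, a s t ∂ν ∂ν ≤ η) :
    ∃ c : Fin M → S, ∀ m, b (c m) + ∑ m' ∈ univ.erase m, a (c m) (c m') ≤ 2 * η := by
  classical
  let cost : (Fin (2 * M) → S) → Fin (2 * M) → ℝ≥0∞ :=
    fun c m => b (c m) + ∑ m' ∈ univ.erase m, a (c m) (c m')
  have ham : ∀ m m' : Fin (2 * M), Measurable fun c : Fin (2 * M) → S => a (c m) (c m') :=
    fun m m' => ha.comp (g := Function.uncurry a) (f := fun c : Fin (2 * M) → S => (c m, c m'))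
      ((measurable_pi_apply m).prodMk (measurable_pi_apply m'))
  have hbm : ∀ m : Fin (2 * M), Measurable fun c : Fin (2 * M) → S => b (c m) :=
    fun m => hb.comp (measurable_pi_apply m)
  have hcm : ∀ m, Measurable fun c => cost c m := fun m =>
    (hbm m).add (Finset.measurable_fun_sum _ fun m' _ => ham m m')
  have hint : ∀ m, ∫⁻ c, cost c m ∂Measure.pi (fun _ => ν) ≤ η := by
    intro m
    refine le_trans ?_ h
    rw [lintegral_add_left (hbm m), lintegral_finsetSum _ fun m' _ => ham m m',
      (measurePreserving_eval (fun _ : Fin (2 * M) => ν) m).lintegral_comp hb]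
    gcongr
    calc ∑ m' ∈ univ.erase m, ∫⁻ c, a (c m) (c m') ∂Measure.pi (fun _ => ν)
        = ∑ m' ∈ univ.erase m, ∫⁻ s, ∫⁻ t, a s t ∂ν ∂ν :=
          Finset.sum_congr rfl fun m' hm' => lintegral_pi_pair ν ha (ne_of_mem_erase hm').symm
      _ ≤ ∑ m' : Fin (2 * M), ∫⁻ s, ∫⁻ t, a s t ∂ν ∂ν :=
          Finset.sum_le_sum_of_subset (erase_subset _ _)
      _ = _ := by simp
  obtain ⟨c, hc⟩ := exists_le_lintegral (μ := Measure.pi fun _ : Fin (2 * M) => ν)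
    (f := fun c => ∑ m, cost c m) (Finset.measurable_fun_sum _ fun m _ => hcm m).aemeasurable
  rw [lintegral_finsetSum _ fun m _ => hcm m] at hc
  replace hc : ∑ m, cost c m ≤ (2 * M : ℕ) * η :=
    hc.trans ((Finset.sum_le_sum fun m _ => hint m).trans (by simp))
  let good : Finset (Fin (2 * M)) := univ.filter fun m => cost c m ≤ 2 * η
  -- Markov's inequality for the counting measure: the total cost is at most `2 M η`, so at most
  -- half of the `2 M` points cost more than `2 η`.
  have hbad : (univ.filter fun m => ¬ cost c m ≤ 2 * η).card ≤ M := by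
    have h1 : ((univ.filter fun m => ¬ cost c m ≤ 2 * η).card : ℝ≥0∞) * (2 * η) ≤ M * (2 * η) :=
      calc _ = ∑ m ∈ univ.filter (fun m => ¬ cost c m ≤ 2 * η), 2 * η := by simp
        _ ≤ ∑ m ∈ univ.filter (fun m => ¬ cost c m ≤ 2 * η), cost c m :=
          Finset.sum_le_sum fun m hm => (not_le.1 (mem_filter.1 hm).2).le
        _ ≤ ∑ m, cost c m := Finset.sum_le_sum_of_subset (filter_subset _ _)
        _ ≤ _ := hc
        _ = _ := by push_cast; ring
    have h2 := (ENNReal.mul_le_mul_iff_left (mul_ne_zero two_ne_zero hη0)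
      (ENNReal.mul_ne_top ENNReal.ofNat_ne_top hη)).1 h1
    exact_mod_cast h2
  have hgood : M ≤ good.card := by
    have := Finset.card_filter_add_card_filter_not (s := (univ : Finset (Fin (2 * M))))
      (fun m => cost c m ≤ 2 * η)
    simp only [card_univ, Fintype.card_fin] at this
    have e : good.card = (univ.filter fun m => cost c m ≤ 2 * η).card := rfl
    omega
  let e : Fin M ↪ Fin (2 * M) := (Fin.castLEEmb hgood).trans (good.orderEmbOfFin rfl).toEmbedding
  refine ⟨fun m => c (e m), fun m => ?_⟩
  have hm : cost c (e m) ≤ 2 * η :=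
    (mem_filter.1 (good.orderEmbOfFin_mem rfl (Fin.castLEEmb hgood m))).2
  -- Costs are nonnegative, so discarding points only lowers the costs of those that remain.
  refine le_trans ?_ hm
  simp only [cost]
  gcongr
  calc ∑ m' ∈ univ.erase m, a (c (e m)) (c (e m'))
      = ∑ m' ∈ (univ.erase m).map e, a (c (e m)) (c m') := by rw [sum_map]
    _ ≤ _ := Finset.sum_le_sum_of_subset fun x hx => by
        obtain ⟨m', h1, rfl⟩ := mem_map.1 hx
        exact mem_erase.2 ⟨fun h => (mem_erase.1 h1).1 (e.injective h), mem_univ _⟩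

end RandomSelection

/-! ### Typical words and the size of Hamming balls. -/

section Words

variable {X : Type*} [DecidableEq X]

/-- `c` uses letters of positive probability only, and the frequency of each letter is within `δ` of
its probability. -/
def Typical (P : PMF X) (δ : ℝ) {n : ℕ} (c : Fin n → X) : Prop :=
  (∀ i, P (c i) ≠ 0) ∧ ∀ x, |∑ i, (if c i = x then (1 : ℝ) else 0) - n * (P x).toReal| ≤ n * δ

theorem Typical.mono {P : PMF X} {δ δ' : ℝ} {n : ℕ} {c : Fin n → X} (h : Typical P δ c)
    (hδ : δ ≤ δ') : Typical P δ' c :=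
  ⟨h.1, fun x => (h.2 x).trans (by gcongr)⟩

variable [Fintype X]

/-- An additive functional depends on a word only through its letter counts. This one estimate
serves for log-probabilities, information densities, divergences and log-moments. -/
theorem Typical.abs_sum_sub_le {P : PMF X} {δ : ℝ} {n : ℕ} {c : Fin n → X} (h : Typical P δ c)
    (f : X → ℝ) :
    |∑ i, f (c i) - n * ∑ x, (P x).toReal * f x| ≤ n * (δ * ∑ x, |f x|) := by
  have e : ∑ i, f (c i) - n * ∑ x, (P x).toReal * f x
      = ∑ x, (∑ i, (if c i = x then (1 : ℝ) else 0) - n * (P x).toReal) * f x := by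
    simp only [sub_mul, Finset.sum_sub_distrib, Finset.sum_mul, Finset.mul_sum, mul_assoc]
    rw [Finset.sum_comm]
    simp
  rw [e, Finset.mul_sum, Finset.mul_sum]
  refine (Finset.abs_sum_le_sum_abs _ _).trans (Finset.sum_le_sum fun x _ => ?_)
  rw [abs_mul, ← mul_assoc]
  exact mul_le_mul_of_nonneg_right (h.2 x) (abs_nonneg _)

/-- A Chernoff argument: the generating function of the distance, summed over all words, factors
over the coordinates, and each factor is at most `1 + |X| t ≤ exp (|X| t)`. -/
theorem card_hammingBall_le {n : ℕ} (c : Fin n → X) {t r : ℝ} (ht : 0 < t) (ht1 : t ≤ 1) :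
    ((Finset.univ.filter fun c' : Fin n → X => (hammingDist c c' : ℝ) ≤ r).card : ℝ) ≤
      Real.exp (r * Real.log (1 / t) + n * (Fintype.card X * t)) := by
  have hd : ∀ c' : Fin n → X, t ^ (hammingDist c c') = ∏ i, if c i = c' i then 1 else t := by
    intro c'
    rw [Finset.prod_ite, Finset.prod_const_one, one_mul, Finset.prod_const]
    rfl
  have hsum : ∑ c' : Fin n → X, t ^ (hammingDist c c') ≤ Real.exp (n * (Fintype.card X * t)) := by
    simp_rw [hd]
    have : ∑ c' : Fin n → X, ∏ i, (if c i = c' i then (1 : ℝ) else t)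
        = ∏ i, ∑ x, (if c i = x then (1 : ℝ) else t) := by
      rw [Finset.prod_univ_sum, Fintype.piFinset_univ]
    rw [this, Real.exp_nat_mul]
    calc ∏ i, ∑ x, (if c i = x then (1 : ℝ) else t)
        ≤ ∏ _i : Fin n, Real.exp (Fintype.card X * t) := by
          refine Finset.prod_le_prod (fun i _ => Finset.sum_nonneg fun x _ => by split_ifs <;> positivity)
            fun i _ => ?_
          calc ∑ x, (if c i = x then (1 : ℝ) else t) ≤ ∑ x, ((if c i = x then (1 : ℝ) else 0) + t) :=
                Finset.sum_le_sum fun x _ => by split_ifs <;> linarith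
            _ = Fintype.card X * t + 1 := by simp [Finset.sum_add_distrib, add_comm]
            _ ≤ _ := Real.add_one_le_exp _
      _ = _ := by simp
  rw [Real.exp_add]
  calc ((Finset.univ.filter fun c' : Fin n → X => (hammingDist c c' : ℝ) ≤ r).card : ℝ)
      = ∑ c' ∈ Finset.univ.filter fun c' : Fin n → X => (hammingDist c c' : ℝ) ≤ r, (1 : ℝ) := by
        simp
    _ ≤ ∑ c' ∈ Finset.univ.filter fun c' : Fin n → X => (hammingDist c c' : ℝ) ≤ r,
          Real.exp (r * Real.log (1 / t)) * t ^ (hammingDist c c') := by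
        refine Finset.sum_le_sum fun c' hc' => ?_
        have hr := (Finset.mem_filter.1 hc').2
        rw [← Real.rpow_natCast, Real.rpow_def_of_pos ht, ← Real.exp_add, one_div, Real.log_inv]
        refine Real.one_le_exp ?_
        nlinarith [Real.log_nonpos ht.le ht1]
    _ ≤ ∑ c' : Fin n → X, Real.exp (r * Real.log (1 / t)) * t ^ (hammingDist c c') :=
        Finset.sum_le_sum_of_subset_of_nonneg (Finset.filter_subset _ _)
          fun _ _ _ => by positivity
    _ ≤ _ := by rw [← Finset.mul_sum]; gcongr

end Words

/-! ### Random codewords: typicality, collisions and averaged output. -/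

section RandomCodewords

variable {X Y : Type*} [Fintype X] [MeasurableSpace Y]

theorem sum_pmf (P : PMF X) : ∑ x, P x = 1 := by rw [← tsum_fintype (L := .unconditional X)]; exact P.tsum_coe

theorem sum_toReal_pmf (P : PMF X) : ∑ x, (P x).toReal = 1 := by
  rw [← ENNReal.toReal_sum fun x _ => P.apply_ne_top x, sum_pmf, ENNReal.toReal_one]

instance (W : X → Measure Y) [∀ x, IsProbabilityMeasure (W x)] (P : PMF X) :
    IsProbabilityMeasure (outputLaw W P) :=
  ⟨by simp [outputLaw, sum_pmf]⟩

instance (W : X → Measure Y) [∀ x, IsProbabilityMeasure (W x)] {n : ℕ} (c : Fin n → X) :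
    IsProbabilityMeasure (channelPow W c) := by
  unfold channelPow; infer_instance

variable [MeasurableSpace X] [MeasurableSingletonClass X]

/-- The law of a word of `n` independent letters of law `P`. -/
noncomputable def wordLaw (P : PMF X) (n : ℕ) : Measure (Fin n → X) := Measure.pi fun _ => P.toMeasure

instance (P : PMF X) (n : ℕ) : IsProbabilityMeasure (wordLaw P n) := by
  unfold wordLaw; infer_instance

theorem wordLaw_singleton {X : Type*} [MeasurableSpace X] [MeasurableSingletonClass X] (P : PMF X) {n : ℕ} (c : Fin n → X) :
    wordLaw P n {c} = ∏ i, P (c i) := by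
  rw [wordLaw, Measure.pi_singleton]
  exact Finset.prod_congr rfl fun i _ =>
    P.toMeasure_apply_singleton _ (measurableSet_singleton _)

/-- Expanding the product of mixtures shows that the output of a random codeword is i.i.d. of law
`W_P`. The chance that an unrelated codeword passes a test is thereby computed under that law. -/
theorem lintegral_channelPow (W : X → Measure Y) [∀ x, IsProbabilityMeasure (W x)] (P : PMF X)
    {n : ℕ} (A : Set (Fin n → Y)) :
    ∫⁻ c, channelPow W c A ∂wordLaw P n = Measure.pi (fun _ : Fin n => outputLaw W P) A := by
  have h : Measure.pi (fun _ : Fin n => outputLaw W P)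
      = ∑ c : Fin n → X, (∏ i, P (c i)) • channelPow W c := by
    classical
    refine Measure.pi_eq fun s _ => ?_
    simp only [Measure.coe_finsetSum, Finset.sum_apply, Measure.smul_apply, smul_eq_mul,
      channelPow, Measure.pi_pi, outputLaw, Finset.prod_univ_sum, Fintype.piFinset_univ,
      Finset.prod_mul_distrib]
  rw [lintegral_fintype, h]
  simp [wordLaw_singleton, mul_comm]

variable [DecidableEq X]

theorem wordLaw_not_typical_le (P : PMF X) {δ : ℝ} (hδ : 0 < δ) {n : ℕ} (hn : 0 < n) :
    wordLaw P n {c | ¬ Typical P δ c} ≤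
      Fintype.card X * (2 * ENNReal.ofReal (1 / (n * δ ^ 2))) := by
  have hn' : (0 : ℝ) < n := by exact_mod_cast hn
  have hs : 0 < n * δ := by positivity
  let f : X → X → ℝ := fun x z => if z = x then 1 else 0
  have hf : ∀ x z, |f x z| ≤ 1 := fun x z => by simp only [f]; split_ifs <;> simp
  have hfP : ∀ x, ∫ z, f x z ∂P.toMeasure = (P x).toReal := by
    intro x
    rw [integral_fintype (Integrable.of_finite)]
    simp [f, Measure.real, P.toMeasure_apply_singleton _ (measurableSet_singleton _)]
  have hcheb : (Fintype.card (Fin n) : ℝ) * 1 ^ 2 / (n * δ) ^ 2 = 1 / (n * δ ^ 2) := by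
    rw [Fintype.card_fin]; field_simp
  -- The support clause of typicality fails on a null set only; Chebyshev, on both sides and for
  -- each letter, handles the frequencies.
  have hsupp : wordLaw P n {c | ∃ i, P (c i) = 0} = 0 := by
    have h0 : ∀ i : Fin n, ∀ᵐ z ∂P.toMeasure, P z ≠ 0 := fun _ => by
      rw [ae_iff_of_countable]
      intro x hx
      rwa [P.toMeasure_apply_singleton _ (measurableSet_singleton _)] at hx
    have := ae_pi_eval (μ := fun _ : Fin n => P.toMeasure) h0
    rw [ae_iff] at this
    simpa [wordLaw] using this
  calc wordLaw P n {c | ¬ Typical P δ c}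
      ≤ wordLaw P n ({c | ∃ i, P (c i) = 0} ∪ ⋃ x ∈ (Finset.univ : Finset X),
          ({c | ∑ i, f x (c i) ≤ ∑ i : Fin n, ∫ z, f x z ∂P.toMeasure - n * δ} ∪
          {c | ∑ i : Fin n, ∫ z, f x z ∂P.toMeasure + n * δ ≤ ∑ i, f x (c i)})) := by
        refine measure_mono fun c hc => ?_
        by_contra hcon
        simp only [Set.mem_union, Set.mem_ofPred_eq, Set.mem_iUnion, not_or, not_exists, hfP,
          Finset.mem_univ, forall_true_left, not_le, Finset.sum_const, Finset.card_univ,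
          Fintype.card_fin, nsmul_eq_mul] at hcon
        refine hc ⟨hcon.1, fun x => abs_le.2 ⟨?_, ?_⟩⟩
        · have := (hcon.2 x).1; simp only [f] at this; linarith
        · have := (hcon.2 x).2; simp only [f] at this; linarith
    _ ≤ 0 + ∑ x : X, 2 * ENNReal.ofReal (1 / (n * δ ^ 2)) := by
        refine (measure_union_le _ _).trans (add_le_add hsupp.le
          ((measure_biUnion_finset_le _ _).trans (Finset.sum_le_sum fun x _ => ?_)))
        refine (measure_union_le _ _).trans ?_
        rw [two_mul, ← hcheb]
        exact add_le_add
          (pi_sum_le_mean_sub _ (fun _ => measurable_of_finite (f x)) (fun _ => hf x) hs)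
          (pi_mean_add_le_sum _ (fun _ => measurable_of_finite (f x)) (fun _ => hf x) hs)
    _ = _ := by simp

theorem Typical.wordLaw_singleton_le {P : PMF X} {δ : ℝ} {n : ℕ} {c : Fin n → X}
    (h : Typical P δ c) :
    wordLaw P n {c} ≤ ENNReal.ofReal (Real.exp (n * (∑ x, (P x).toReal * Real.log (P x).toReal
      + δ * ∑ x, |Real.log (P x).toReal|))) := by
  have hp : ∀ i, 0 < (P (c i)).toReal := fun i => ENNReal.toReal_pos (h.1 i) (P.apply_ne_top _)
  have e : wordLaw P n {c} = ENNReal.ofReal (Real.exp (∑ i, Real.log (P (c i)).toReal)) := by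
    rw [wordLaw_singleton, Real.exp_sum, ENNReal.ofReal_prod_of_nonneg fun i _ => (Real.exp_pos _).le]
    refine Finset.prod_congr rfl fun i _ => ?_
    rw [Real.exp_log (hp i), ENNReal.ofReal_toReal (P.apply_ne_top _)]
  rw [e]
  refine ENNReal.ofReal_le_ofReal (Real.exp_le_exp.2 ?_)
  have := (abs_le.1 (h.abs_sum_sub_le fun x => Real.log (P x).toReal)).2
  linarith

/-- A typical random word is unlikely to be close to a given word. -/
theorem wordLaw_typical_close_le (P : PMF X) {δ ε t : ℝ} (ht : 0 < t) (ht1 : t ≤ 1) {n : ℕ}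
    (c : Fin n → X) :
    wordLaw P n {c' | Typical P δ c' ∧ (hammingDist c c' : ℝ) ≤ ε * n} ≤
      ENNReal.ofReal (Real.exp (n * (∑ x, (P x).toReal * Real.log (P x).toReal
        + δ * ∑ x, |Real.log (P x).toReal| + ε * Real.log (1 / t) + Fintype.card X * t))) := by
  classical
  set K : ℝ := n * (∑ x, (P x).toReal * Real.log (P x).toReal
    + δ * ∑ x, |Real.log (P x).toReal|) with hK
  calc _ = wordLaw P n (⋃ c' ∈ Finset.univ.filter fun c' : Fin n → X =>
          Typical P δ c' ∧ (hammingDist c c' : ℝ) ≤ ε * n, {c'}) := by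
        congr 1; ext; simp
    _ ≤ ∑ c' ∈ Finset.univ.filter fun c' : Fin n → X =>
          Typical P δ c' ∧ (hammingDist c c' : ℝ) ≤ ε * n, ENNReal.ofReal (Real.exp K) :=
        (measure_biUnion_finset_le _ _).trans <| Finset.sum_le_sum fun c' hc' =>
          (Finset.mem_filter.1 hc').2.1.wordLaw_singleton_le
    _ ≤ ∑ c' ∈ Finset.univ.filter fun c' : Fin n → X =>
          (hammingDist c c' : ℝ) ≤ ε * n, ENNReal.ofReal (Real.exp K) :=
        Finset.sum_le_sum_of_subset fun x hx => by simp at hx ⊢; exact hx.2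
    _ = ENNReal.ofReal ((Finset.univ.filter fun c' : Fin n → X =>
          (hammingDist c c' : ℝ) ≤ ε * n).card * Real.exp K) := by
        rw [ENNReal.ofReal_mul (Nat.cast_nonneg _), ENNReal.ofReal_natCast]; simp
    _ ≤ _ := by
        refine ENNReal.ofReal_le_ofReal ?_
        refine (mul_le_mul_of_nonneg_right (card_hammingBall_le c ht ht1)
          (Real.exp_pos _).le).trans_eq ?_
        rw [← Real.exp_add, hK]
        congr 1; ring

end RandomCodewords

/-! ### Separating test functions from non-redundancy. -/

section Separation

variable {X Y : Type*} [Fintype X] [MeasurableSpace Y]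

theorem outputLaw_real_apply (W : X → Measure Y) [∀ x, IsProbabilityMeasure (W x)] (P : PMF X)
    (A : Set Y) : (outputLaw W P).real A = ∑ x, (P x).toReal * (W x).real A := by
  simp only [outputLaw, Measure.real, Measure.coe_finsetSum, Finset.sum_apply, Measure.smul_apply,
    smul_eq_mul]
  rw [ENNReal.toReal_sum fun x _ => ENNReal.mul_ne_top (P.apply_ne_top x) (measure_ne_top _ _)]
  simp

/-- A mixture equal to `W x` would make the infimum zero. The tests below use (W2) only in this
qualitative form. -/
theorem NonRedundant.ne_outputLaw {W : X → Measure Y} [∀ x, IsProbabilityMeasure (W x)]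
    (hW : NonRedundant W) {P : PMF X} {x : X} (hP : P x = 0) : W x ≠ outputLaw W P := by
  intro h
  have h0 : klDiv2 (outputLaw W P) (W x) = 0 := by
    rw [klDiv2, ← h, (InformationTheory.klDiv_eq_zero_iff).2 rfl, ENNReal.zero_div]
  exact absurd hW (not_lt.2 ((iInf_le_of_le x (iInf_le_of_le P (iInf_le _ hP))).trans h0.le))

/-- Densities of finitely many probability measures with respect to their sum. -/
theorem exists_bounded_densities (W : X → Measure Y) [∀ x, IsProbabilityMeasure (W x)] :
    ∃ F : X → Y → ℝ, (∀ x, Measurable (F x)) ∧ (∀ x y, |F x y| ≤ 1) ∧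
      ∀ x, ∀ g : Y → ℝ, ∫ y, g y ∂W x = ∫ y, F x y * g y ∂(∑ z, W z) := by
  have hle : ∀ x, W x ≤ ∑ z, W z := fun x =>
    Measure.le_iff.2 fun s _ => by
      rw [Measure.coe_finsetSum, Finset.sum_apply]
      exact Finset.single_le_sum (f := fun z => W z s) (fun _ _ => zero_le) (Finset.mem_univ x)
  -- As `W x` is dominated by the sum, its density is at most 1 almost everywhere; truncation turns
  -- this into a pointwise bound at no cost.
  refine ⟨fun x y => min ((W x).rnDeriv (∑ z, W z) y).toReal 1, fun x => ?_, fun x y => ?_,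
    fun x g => ?_⟩
  · exact (Measure.measurable_rnDeriv _ _).ennreal_toReal.min measurable_const
  · rw [abs_of_nonneg (le_min ENNReal.toReal_nonneg zero_le_one)]
    exact min_le_right _ _
  · rw [← integral_rnDeriv_smul (Measure.absolutelyContinuous_of_le (hle x))]
    refine integral_congr_ae ?_
    filter_upwards [Measure.rnDeriv_le_one_of_le (hle x)] with y hy
    rw [min_eq_left, smul_eq_mul]
    exact ENNReal.toReal_le_of_le_ofReal zero_le_one (by simpa using hy)

/-- Each law is encoded by its finitely many moments against the densities `F z`. These moments
determine mixtures of the `W z`, so (W2) puts the vector of `W x` outside the compact convex hull of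
the other vectors, and a separating functional is integration of a combination of the `F z`. -/
theorem NonRedundant.exists_test_at {W : X → Measure Y} [∀ x, IsProbabilityMeasure (W x)]
    (hW : NonRedundant W) (x : X) :
    ∃ (ξ : Y → ℝ) (B : ℝ), Measurable ξ ∧ (∀ y, |ξ y| ≤ B) ∧ ∫ y, ξ y ∂W x = 0 ∧
      ∀ x', x' ≠ x → ∫ y, ξ y ∂W x' < 0 := by
  classical
  obtain ⟨F, hFm, hFb, hF⟩ := exists_bounded_densities W
  set μ : Measure Y := ∑ z, W z with hμ
  have hbi : ∀ (ρ : Measure Y) [IsFiniteMeasure ρ] (g : Y → ℝ) (_ : Measurable g) (C : ℝ)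
      (_ : ∀ y, |g y| ≤ C), Integrable g ρ := fun ρ _ g hg C hC =>
    Integrable.of_bound hg.aestronglyMeasurable C (ae_of_all _ hC)
  have hFF : ∀ x z, Integrable (fun y => F x y * F z y) μ := fun x z =>
    hbi μ _ ((hFm x).mul (hFm z)) 1 fun y => by
      rw [abs_mul]; exact mul_le_one₀ (hFb x y) (abs_nonneg _) (hFb z y)
  let V : X → X → ℝ := fun x' z => ∫ y, F z y ∂W x'
  let Φ : (X → ℝ) →ₗ[ℝ] (X → ℝ) := ∑ x', (LinearMap.proj x').smulRight (V x')
  have hΦ : ∀ w, Φ w = ∑ x', w x' • V x' := fun w => by simp [Φ]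
  let D : Set (X → ℝ) := stdSimplex ℝ X ∩ {w | w x = 0}
  have hDconv : Convex ℝ D := (convex_stdSimplex ℝ X).inter fun u hu v hv a b _ _ _ => by
    simp only [Set.mem_ofPred_eq, Pi.add_apply, Pi.smul_apply, smul_eq_mul] at *
    rw [hu, hv]; simp
  have hDcomp : IsCompact D := (isCompact_stdSimplex ℝ X).inter_right
    (isClosed_eq (continuous_apply x) continuous_const)
  have hnot : V x ∉ Φ '' D := by
    rintro ⟨w, ⟨⟨hw0, hw1⟩, hwx⟩, hw⟩
    let h : Y → ℝ := fun y => F x y - ∑ x', w x' * F x' y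
    have hh : ∀ y, |h y| ≤ 2 := fun y => by
      refine (abs_sub _ _).trans (le_trans (add_le_add (hFb x y) ?_) one_add_one_eq_two.le)
      refine (Finset.abs_sum_le_sum_abs _ _).trans ?_
      rw [← hw1]
      refine Finset.sum_le_sum fun x' _ => ?_
      rw [abs_mul, abs_of_nonneg (hw0 x')]
      exact mul_le_of_le_one_right (hw0 x') (hFb x' y)
    have hhm : Measurable h :=
      (hFm x).sub (Finset.measurable_fun_sum _ fun x' _ => (hFm x').const_mul _)
    have horth : ∀ z, ∫ y, F z y * h y ∂μ = 0 := by
      intro z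
      have e : ∀ y, F z y * h y = F x y * F z y - ∑ x', w x' * (F x' y * F z y) := fun y => by
        simp only [h, mul_sub, Finset.mul_sum]
        congr 1
        · ring
        · exact Finset.sum_congr rfl fun _ _ => by ring
      simp_rw [e]
      rw [integral_sub (hFF x z) (integrable_finsetSum _ fun x' _ => (hFF x' z).const_mul _),
        integral_finsetSum _ fun x' _ => (hFF x' z).const_mul _]
      simp_rw [integral_const_mul, ← hF]
      have := congrFun hw z
      rw [hΦ, Finset.sum_apply] at this
      simp only [Pi.smul_apply, smul_eq_mul, V] at this
      rw [this, sub_self]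
    have hFh : ∀ z, Integrable (fun y => F z y * h y) μ := fun z =>
      hbi μ _ ((hFm z).mul hhm) 2 fun y => by
        rw [abs_mul]
        nlinarith [hFb z y, hh y, abs_nonneg (F z y), abs_nonneg (h y)]
    have hsq : ∫ y, h y * h y ∂μ = 0 := by
      have e : ∀ y, h y * h y = F x y * h y - ∑ x', w x' * (F x' y * h y) := fun y => by
        conv_lhs => rw [show h y = F x y - ∑ x', w x' * F x' y from rfl]
        rw [sub_mul, Finset.sum_mul]
        congr 1
        exact Finset.sum_congr rfl fun _ _ => by
          rw [show h y = F x y - ∑ x', w x' * F x' y from rfl]; ring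
      simp_rw [e]
      rw [integral_sub (hFh x) (integrable_finsetSum _ fun x' _ => (hFh x').const_mul _),
        integral_finsetSum _ fun x' _ => (hFh x').const_mul _]
      simp_rw [integral_const_mul, horth]
      simp
    have hzero : h =ᵐ[μ] 0 := by
      have := (integral_eq_zero_iff_of_nonneg (fun y => mul_self_nonneg (h y))
        (hbi μ _ (hhm.mul hhm) 4 fun y => by
          rw [abs_mul]; nlinarith [hh y, abs_nonneg (h y)])).1 hsq
      filter_upwards [this] with y hy
      simpa using hy
    let P : PMF X := PMF.ofFintype (fun x' => ENNReal.ofReal (w x')) (by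
      rw [← ENNReal.ofReal_sum_of_nonneg fun x' _ => hw0 x', hw1, ENNReal.ofReal_one])
    have hP : ∀ x', (P x').toReal = w x' := fun x' => ENNReal.toReal_ofReal (hw0 x')
    refine hW.ne_outputLaw (P := P) (x := x) (by
      change ENNReal.ofReal (w x) = 0
      rw [hwx, ENNReal.ofReal_zero]) (Measure.ext fun A hA => ?_)
    rw [← measureReal_eq_measureReal_iff, outputLaw_real_apply]
    have hreal : ∀ z, (W z).real A = ∫ y, F z y * A.indicator 1 y ∂μ := fun z => by
      rw [← hF, integral_indicator_one hA]
    have hFA : ∀ z, Integrable (fun y => F z y * A.indicator 1 y) μ := fun z =>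
      hbi μ _ ((hFm z).mul (measurable_one.indicator hA)) 1 fun y => by
        rw [abs_mul]
        refine mul_le_one₀ (hFb z y) (abs_nonneg _) ?_
        by_cases hy : y ∈ A <;> simp [hy]
    simp_rw [hP, hreal, ← integral_const_mul]
    rw [← integral_finsetSum _ fun x' _ => (hFA x').const_mul _]
    refine integral_congr_ae ?_
    filter_upwards [hzero] with y hy
    rw [sub_eq_zero.1 hy, Finset.sum_mul]
    exact Finset.sum_congr rfl fun _ _ => by ring
  obtain ⟨f, u, hf1, hf2⟩ := geometric_hahn_banach_point_closed
    (hDconv.linear_image Φ) (hDcomp.image Φ.continuous_of_finiteDimensional).isClosed hnot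
  let k : X → ℝ := fun z => f fun j => if z = j then 1 else 0
  have hfV : ∀ v : X → ℝ, f v = ∑ z, v z * k z := fun v =>
    LinearMap.pi_apply_eq_sum_univ f.toLinearMap v
  let g : Y → ℝ := fun y => ∑ z, k z * F z y
  have hgm : Measurable g := Finset.measurable_fun_sum _ fun z _ => (hFm z).const_mul _
  have hgb : ∀ y, |g y| ≤ ∑ z, |k z| := fun y =>
    (Finset.abs_sum_le_sum_abs _ _).trans <| Finset.sum_le_sum fun z _ => by
      rw [abs_mul]; exact mul_le_of_le_one_right (abs_nonneg _) (hFb z y)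
  have hg : ∀ x', ∫ y, g y ∂W x' = f (V x') := fun x' => by
    rw [hfV, integral_finsetSum _ fun z _ => (hbi (W x') _ (hFm z) 1 (hFb z)).const_mul _]
    simp_rw [integral_const_mul]
    exact Finset.sum_congr rfl fun z _ => mul_comm _ _
  have hgi : ∀ x', ∫ y, (f (V x) - g y) ∂W x' = f (V x) - f (V x') := fun x' => by
    rw [integral_sub (integrable_const _) (hbi _ _ hgm _ hgb), hg]
    simp
  refine ⟨fun y => f (V x) - g y, |f (V x)| + ∑ z, |k z|, measurable_const.sub hgm,
    fun y => (abs_sub _ _).trans (by linarith [hgb y]), by rw [hgi, sub_self], fun x' hx' => ?_⟩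
  rw [hgi]
  have : V x' ∈ Φ '' D := ⟨Pi.single x' 1, ⟨single_mem_stdSimplex ℝ x',
    by simp [Pi.single_eq_of_ne hx'.symm]⟩, by
      rw [hΦ, Finset.sum_eq_single x' (fun b _ hb => by simp [Pi.single_eq_of_ne hb]) (by simp)]
      simp⟩
  linarith [hf2 _ this]

/-- Test functions that separate every output distribution from all the others at once. -/
theorem NonRedundant.exists_test {W : X → Measure Y} [∀ x, IsProbabilityMeasure (W x)]
    (hW : NonRedundant W) :
    ∃ (ξ : X → Y → ℝ) (B ζ : ℝ), 0 < ζ ∧ (∀ x, Measurable (ξ x)) ∧ (∀ x y, |ξ x y| ≤ B) ∧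
      (∀ x, ∫ y, ξ x y ∂W x = 0) ∧ ∀ x x', x' ≠ x → ∫ y, ξ x y ∂W x' ≤ -ζ := by
  classical
  choose ξ B hm hB h0 hneg using hW.exists_test_at
  obtain ⟨ζ, hζ, h⟩ : ∃ ζ : ℝ, 0 < ζ ∧ ∀ p : X × X, p.2 ≠ p.1 → ζ ≤ - ∫ y, ξ p.1 y ∂W p.2 := by
    -- There are finitely many pairs of letters, so all small positive `ζ` work for every pair at
    -- once.
    have : ∀ p : X × X, ∀ᶠ ζ in 𝓝[>] (0 : ℝ), p.2 ≠ p.1 → ζ ≤ - ∫ y, ξ p.1 y ∂W p.2 := by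
      intro p
      by_cases hp : p.2 = p.1
      · simp [hp]
      · filter_upwards [Ioo_mem_nhdsGT (neg_pos.2 (hneg p.1 p.2 hp))] with ζ hζ _
        exact hζ.2.le
    obtain ⟨ζ, h1, h2⟩ := ((eventually_all.2 this).and self_mem_nhdsWithin).exists
    exact ⟨ζ, h2, h1⟩
  refine ⟨ξ, ∑ x, |B x|, ζ, hζ, hm, fun x y => (hB x y).trans ((le_abs_self _).trans
    (Finset.single_le_sum (f := fun x => |B x|) (fun _ _ => abs_nonneg _) (Finset.mem_univ x))),
    h0, fun x x' hx => ?_⟩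
  linarith [h (x, x') hx]

end Separation

/-! ### Finiteness of mutual information and a bounded information density. -/

section InformationDensity

variable {X Y : Type*} [Fintype X] [MeasurableSpace Y] {W : X → Measure Y}
  {P : PMF X} {x : X}

theorem smul_le_outputLaw (W : X → Measure Y) (P : PMF X) (x : X) :
    P x • W x ≤ outputLaw W P :=
  Measure.le_iff.2 fun s _ => by
    rw [outputLaw, Measure.coe_finsetSum, Finset.sum_apply]
    exact Finset.single_le_sum (f := fun z => (P z • W z) s) (fun _ _ => zero_le)
      (Finset.mem_univ x)

theorem absolutelyContinuous_outputLaw (hx : P x ≠ 0) : W x ≪ outputLaw W P :=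
  (Measure.AbsolutelyContinuous.rfl.smul_right hx).trans
    (Measure.absolutelyContinuous_of_le (smul_le_outputLaw W P x))

variable [∀ x, IsProbabilityMeasure (W x)]

theorem rnDeriv_outputLaw_le (hx : P x ≠ 0) :
    ∀ᵐ y ∂outputLaw W P, ((W x).rnDeriv (outputLaw W P) y).toReal ≤ 1 / (P x).toReal := by
  filter_upwards [Measure.rnDeriv_le_one_of_le (smul_le_outputLaw W P x),
    Measure.rnDeriv_smul_left_of_ne_top (W x) (outputLaw W P) (P.apply_ne_top x)] with y h1 h2
  rw [h2, Pi.smul_apply, smul_eq_mul] at h1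
  have h3 := ENNReal.toReal_mono ENNReal.one_ne_top h1
  rw [ENNReal.toReal_mul] at h3
  rw [le_div_iff₀' (ENNReal.toReal_pos hx (P.apply_ne_top x))]
  simpa using h3

/-- The density is bounded by `1 / P x`, and `klFun` is continuous on `[0, 1 / P x]`, hence bounded;
it has no singularity at 0, unlike the logarithm. -/
theorem integrable_llr_outputLaw (hx : P x ≠ 0) :
    Integrable (llr (W x) (outputLaw W P)) (W x) := by
  rw [← InformationTheory.integrable_klFun_rnDeriv_iff (absolutelyContinuous_outputLaw hx)]
  obtain ⟨C, hC⟩ := (isCompact_Icc (a := (0 : ℝ)) (b := 1 / (P x).toReal)).exists_bound_of_continuousOn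
    InformationTheory.continuous_klFun.continuousOn
  refine Integrable.of_bound (InformationTheory.measurable_klFun.comp
    (Measure.measurable_rnDeriv _ _).ennreal_toReal).aestronglyMeasurable C ?_
  filter_upwards [rnDeriv_outputLaw_le (W := W) hx] with y hy
  exact hC _ ⟨ENNReal.toReal_nonneg, hy⟩

theorem klDiv_outputLaw_ne_top (hx : P x ≠ 0) :
    InformationTheory.klDiv (W x) (outputLaw W P) ≠ ∞ :=
  InformationTheory.klDiv_ne_top (absolutelyContinuous_outputLaw hx) (integrable_llr_outputLaw hx)

theorem ofReal_log_two_ne_zero : ENNReal.ofReal (Real.log 2) ≠ 0 := by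
  simpa using Real.log_pos one_lt_two

theorem mutualInfo_term_ne_top (W : X → Measure Y) [∀ x, IsProbabilityMeasure (W x)] (P : PMF X)
    (x : X) : P x * klDiv2 (W x) (outputLaw W P) ≠ ∞ := by
  by_cases hx : P x = 0
  · simp [hx]
  · exact ENNReal.mul_ne_top (P.apply_ne_top x)
      (ENNReal.div_ne_top (klDiv_outputLaw_ne_top hx) ofReal_log_two_ne_zero)

theorem mutualInfo_ne_top (W : X → Measure Y) [∀ x, IsProbabilityMeasure (W x)] (P : PMF X) :
    mutualInfo W P ≠ ∞ :=
  ENNReal.sum_ne_top.2 fun x _ => mutualInfo_term_ne_top W P x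

theorem toReal_mutualInfo (W : X → Measure Y) [∀ x, IsProbabilityMeasure (W x)] (P : PMF X) :
    (mutualInfo W P).toReal =
      ∑ x, (P x).toReal * (klDiv2 (W x) (outputLaw W P)).toReal := by
  rw [mutualInfo, ENNReal.toReal_sum fun x _ => mutualInfo_term_ne_top W P x]
  simp

theorem toReal_klDiv2 (P Q : Measure Y) :
    (klDiv2 P Q).toReal = (InformationTheory.klDiv P Q).toReal / Real.log 2 := by
  rw [klDiv2, ENNReal.toReal_div, ENNReal.toReal_ofReal (Real.log_nonneg one_le_two)]

/-- The true density may be unbounded below, which defeats Chebyshev. Mixing the likelihood ratio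
`u` with the constant 1 bounds its logarithm below by `log t` and keeps its integral at most 1. By
concavity `log ((1 - t) u + t) ≥ (1 - t) log u`, so the mean loses at most `t I ≤ η`. -/
theorem exists_information_density (W : X → Measure Y) [∀ x, IsProbabilityMeasure (W x)]
    (P : PMF X) {η : ℝ} (hη : 0 < η) :
    ∃ (g : X → Y → ℝ) (B : ℝ), (∀ x, Measurable (g x)) ∧ (∀ x y, |g x y| ≤ B) ∧
      (∀ x, ∫⁻ y, ENNReal.ofReal (Real.exp (g x y)) ∂outputLaw W P ≤ 1) ∧
      Real.log 2 * (mutualInfo W P).toReal - η ≤ ∑ x, (P x).toReal * ∫ y, g x y ∂W x := by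
  set I : ℝ := Real.log 2 * (mutualInfo W P).toReal with hI
  have hl2 : 0 < Real.log 2 := Real.log_pos one_lt_two
  have hI0 : 0 ≤ I := mul_nonneg hl2.le ENNReal.toReal_nonneg
  obtain ⟨t, ht0, ht1, htI⟩ : ∃ t : ℝ, 0 < t ∧ t < 1 ∧ t * I ≤ η := by
    refine ⟨min (1 / 2) (η / (I + 1)), by positivity, by
      linarith [min_le_left (1 / 2 : ℝ) (η / (I + 1))], ?_⟩
    calc min (1 / 2) (η / (I + 1)) * I ≤ η / (I + 1) * I := by gcongr; exact min_le_right _ _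
      _ = η * (I / (I + 1)) := by ring
      _ ≤ η * 1 := by gcongr; exact div_le_one_of_le₀ (by linarith) (by linarith)
      _ = η := mul_one _
  -- For `P x = 0` the convention `1 / 0 = 0` makes `v x` vanish; such letters carry no weight in
  -- the mean.
  let v : X → Y → ℝ := fun x y =>
    min ((W x).rnDeriv (outputLaw W P) y).toReal (1 / (P x).toReal)
  have hv0 : ∀ x y, 0 ≤ v x y := fun x y => le_min ENNReal.toReal_nonneg (by positivity)
  have hvm : ∀ x, Measurable (v x) := fun x =>
    (Measure.measurable_rnDeriv _ _).ennreal_toReal.min measurable_const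
  have hpos : ∀ x y, t ≤ (1 - t) * v x y + t := fun x y => by
    nlinarith [mul_nonneg (sub_pos.2 ht1).le (hv0 x y)]
  let B : X → ℝ := fun x => |Real.log t| + |Real.log (1 / (P x).toReal + 1)|
  have hB : ∀ x y, |Real.log ((1 - t) * v x y + t)| ≤ B x := fun x y => by
    have h1 : Real.log t ≤ Real.log ((1 - t) * v x y + t) := Real.log_le_log ht0 (hpos x y)
    have h2 : Real.log ((1 - t) * v x y + t) ≤ Real.log (1 / (P x).toReal + 1) := by
      refine Real.log_le_log (ht0.trans_le (hpos x y)) (add_le_add ?_ ht1.le)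
      refine (mul_le_of_le_one_left (hv0 x y) (by linarith)).trans (min_le_right _ _)
    refine abs_le.2 ⟨?_, ?_⟩
    · linarith [neg_abs_le (Real.log t), abs_nonneg (Real.log (1 / (P x).toReal + 1))]
    · linarith [le_abs_self (Real.log (1 / (P x).toReal + 1)), abs_nonneg (Real.log t)]
  have hm : ∀ x, Measurable fun y => Real.log ((1 - t) * v x y + t) := fun x =>
    (((hvm x).const_mul _).add_const _).log
  refine ⟨fun x y => Real.log ((1 - t) * v x y + t), ∑ x, B x, hm,
    fun x y => (hB x y).trans (Finset.single_le_sum (f := B) (fun _ _ => by positivity)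
      (Finset.mem_univ x)), fun x => ?_, ?_⟩
  · calc ∫⁻ y, ENNReal.ofReal (Real.exp (Real.log ((1 - t) * v x y + t))) ∂outputLaw W P
        ≤ ∫⁻ y, (ENNReal.ofReal (1 - t) * (W x).rnDeriv (outputLaw W P) y + ENNReal.ofReal t)
            ∂outputLaw W P := by
          refine lintegral_mono fun y => ?_
          rw [Real.exp_log (ht0.trans_le (hpos x y)), ENNReal.ofReal_add
            (mul_nonneg (by linarith) (hv0 x y)) ht0.le, ENNReal.ofReal_mul (by linarith)]
          gcongr
          exact (ENNReal.ofReal_le_ofReal (min_le_left _ _)).trans ENNReal.ofReal_toReal_le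
      _ = ENNReal.ofReal (1 - t) * ∫⁻ y, (W x).rnDeriv (outputLaw W P) y ∂outputLaw W P
            + ENNReal.ofReal t := by
          rw [lintegral_add_right _ measurable_const,
            lintegral_const_mul _ (Measure.measurable_rnDeriv _ _)]
          simp
      _ ≤ ENNReal.ofReal (1 - t) * 1 + ENNReal.ofReal t := by
          gcongr
          exact (Measure.lintegral_rnDeriv_le).trans (by simp)
      _ = 1 := by
          rw [mul_one, ← ENNReal.ofReal_add (by linarith) ht0.le, sub_add_cancel,
            ENNReal.ofReal_one]
  · have key : ∀ x, P x ≠ 0 → (1 - t) * (InformationTheory.klDiv (W x) (outputLaw W P)).toReal ≤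
        ∫ y, Real.log ((1 - t) * v x y + t) ∂W x := by
      intro x hx
      have hac := absolutelyContinuous_outputLaw (W := W) hx
      rw [InformationTheory.toReal_klDiv_of_measure_eq hac (by simp), ← integral_const_mul]
      refine integral_mono_ae ((integrable_llr_outputLaw hx).const_mul _)
        (Integrable.of_bound (hm x).aestronglyMeasurable (B x) (ae_of_all _ (hB x))) ?_
      filter_upwards [hac.ae_le (rnDeriv_outputLaw_le (W := W) hx),
        ae_rnDeriv_pos_lt_top hac] with y h1 h2
      have hu : 0 < ((W x).rnDeriv (outputLaw W P) y).toReal :=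
        ENNReal.toReal_pos h2.1.ne' h2.2.ne
      have hc := strictConcaveOn_log_Ioi.concaveOn.2 (Set.mem_Ioi.2 hu)
        (Set.mem_Ioi.2 zero_lt_one) (sub_pos.2 ht1).le ht0.le (sub_add_cancel 1 t)
      simp only [smul_eq_mul, Real.log_one, mul_zero, add_zero, mul_one] at hc
      simpa only [llr, v, min_eq_left h1] using hc
    calc I - η ≤ (1 - t) * I := by linarith
      _ = ∑ x, (P x).toReal * ((1 - t) * (InformationTheory.klDiv (W x) (outputLaw W P)).toReal) := by
        rw [hI, toReal_mutualInfo, Finset.mul_sum, Finset.mul_sum]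
        refine Finset.sum_congr rfl fun x _ => ?_
        rw [toReal_klDiv2]
        field_simp
      _ ≤ _ := Finset.sum_le_sum fun x _ => by
        by_cases hx : P x = 0
        · simp [hx]
        · exact mul_le_mul_of_nonneg_left (key x hx) ENNReal.toReal_nonneg

end InformationDensity

/-! ### Threshold decoders and random coding. -/

section CodeConstruction

variable {X Y : Type*} [MeasurableSpace Y] {n M L : ℕ}

open Classical in
/-- The code with encoder `c` that lists the messages whose codeword passes the test `D`, unless
there are more than `L` of them. -/
noncomputable def thresholdCode (hL : 0 < L) (hLM : L < M) (c : Fin M → (Fin n → X))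
    (D : (Fin n → X) → Set (Fin n → Y)) (hD : ∀ x, MeasurableSet (D x)) : ListCode X Y n where
  M := M
  L := L
  L_pos := hL
  L_lt_M := hLM
  enc := c
  dec y := if (Finset.univ.filter fun m => y ∈ D (c m)).card ≤ L then
    Finset.univ.filter fun m => y ∈ D (c m) else ∅
  card_dec_le y := by split_ifs with h <;> simp [h]
  measurableSet_dec m := by
    have h : Measurable fun y : Fin n → Y => ∑ m, (D (c m)).indicator (1 : (Fin n → Y) → ℕ) y :=
      Finset.measurable_fun_sum _ fun m _ => measurable_one.indicator (hD _)
    have e : {y | m ∈ if (Finset.univ.filter fun m => y ∈ D (c m)).card ≤ L then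
        Finset.univ.filter fun m => y ∈ D (c m) else ∅}
        = (fun y : Fin n → Y => ∑ m, (D (c m)).indicator (1 : (Fin n → Y) → ℕ) y) ⁻¹' Set.Iic L
          ∩ D (c m) := by
      ext y
      have hy : ∑ m, (D (c m)).indicator (1 : (Fin n → Y) → ℕ) y
          = (Finset.univ.filter fun m => y ∈ D (c m)).card := by
        simp [Set.indicator_apply, Finset.sum_boole]
      simp only [Set.mem_ofPred_eq, Set.mem_inter_iff, Set.mem_preimage, Set.mem_Iic, hy]
      split_ifs with h <;> simp [h]
    rw [e]
    exact (h measurableSet_Iic).inter (hD _)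

variable {hL : 0 < L} {hLM : L < M} {c : Fin M → (Fin n → X)} {D : (Fin n → X) → Set (Fin n → Y)}
  {hD : ∀ x, MeasurableSet (D x)}

open Classical in
theorem mem_thresholdCode_dec {m : Fin M} {y : Fin n → Y} :
    m ∈ (thresholdCode hL hLM c D hD).dec y ↔
      (Finset.univ.filter fun m => y ∈ D (c m)).card ≤ L ∧ y ∈ D (c m) := by
  change m ∈ (if (Finset.univ.filter fun m => y ∈ D (c m)).card ≤ L then
    Finset.univ.filter fun m => y ∈ D (c m) else ∅) ↔ _
  split_ifs with h <;> simp [h]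

theorem thresholdCode_acceptProb_le (W : X → Measure Y) (m : Fin M) (x : Fin n → X) :
    (thresholdCode hL hLM c D hD).acceptProb W m x ≤ channelPow W x (D (c m)) := by
  exact measure_mono fun y hy => (mem_thresholdCode_dec.1 hy).2

variable (W : X → Measure Y) [∀ x, IsProbabilityMeasure (W x)]

/-- The message is missed only if its own test fails or at least `L` other messages pass; Markov's
inequality bounds the second event. -/
theorem thresholdCode_one_sub_acceptProb_le (m : Fin M) :
    1 - (thresholdCode hL hLM c D hD).acceptProb W m (c m) ≤
      channelPow W (c m) (D (c m))ᶜ +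
        ∑ m' ∈ Finset.univ.erase m, channelPow W (c m) (D (c m')) / L := by
  classical
  have h1 : 1 - (thresholdCode hL hLM c D hD).acceptProb W m (c m)
      = channelPow W (c m) {y | m ∈ (thresholdCode hL hLM c D hD).dec y}ᶜ :=
    (prob_compl_eq_one_sub ((thresholdCode hL hLM c D hD).measurableSet_dec m)).symm
  let N : (Fin n → Y) → ℝ≥0∞ :=
    fun y => ∑ m' ∈ Finset.univ.erase m, (D (c m')).indicator 1 y
  have hN : ∫⁻ y, N y ∂channelPow W (c m)
      = ∑ m' ∈ Finset.univ.erase m, channelPow W (c m) (D (c m')) := by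
    rw [lintegral_finsetSum _ fun m' _ => measurable_one.indicator (hD _)]
    exact Finset.sum_congr rfl fun m' _ => lintegral_indicator_one (hD _)
  have hL0 : (L : ℝ≥0∞) ≠ 0 := by exact_mod_cast hL.ne'
  rw [h1]
  calc _ ≤ channelPow W (c m) ((D (c m))ᶜ ∪ {y | (L : ℝ≥0∞) ≤ N y}) := by
        refine measure_mono fun y hy => ?_
        by_contra hcon
        simp only [Set.mem_union, Set.mem_compl_iff, Set.mem_ofPred_eq, not_or, not_not,
          not_le] at hcon
        refine hy ?_
        have hcard : (Finset.univ.filter fun m => y ∈ D (c m)).card ≤ L := by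
          have h2 : N y = ((Finset.univ.erase m).filter fun m' => y ∈ D (c m')).card := by
            simp [N, Set.indicator_apply, Finset.sum_boole]
          have h3 : ((Finset.univ.erase m).filter fun m' => y ∈ D (c m')).card < L := by
            have := hcon.2
            rw [h2] at this
            exact_mod_cast this
          rw [Finset.filter_erase, Finset.card_erase_of_mem (by simpa using hcon.1)] at h3
          omega
        exact mem_thresholdCode_dec.2 ⟨by convert hcard, hcon.1⟩
    _ ≤ channelPow W (c m) (D (c m))ᶜ + channelPow W (c m) {y | (L : ℝ≥0∞) ≤ N y} :=
        measure_union_le _ _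
    _ ≤ _ := by
        gcongr
        simp_rw [div_eq_mul_inv]
        rw [← Finset.sum_mul, ← hN, ← div_eq_mul_inv]
        exact meas_ge_le_lintegral_div
          (Finset.measurable_fun_sum _ fun m' _ => measurable_one.indicator (hD _)).aemeasurable
          hL0 (ENNReal.natCast_ne_top L)

variable [Fintype X] [DecidableEq X] [MeasurableSpace X] [MeasurableSingletonClass X]

/-- Random coding with expurgation for an arbitrary family of tests. -/
theorem exists_listCode (hL : 0 < L) (hLM : L < M) (P : PMF X)
    {D : (Fin n → X) → Set (Fin n → Y)} (hD : ∀ x, MeasurableSet (D x)) {δ ε : ℝ}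
    {e₁ e₂ p₁ p₂ η : ℝ≥0∞} (hη0 : η ≠ 0) (hη : 2 * η < 1)
    (hown : ∀ c, Typical P δ c → channelPow W c (D c)ᶜ ≤ e₁)
    (hfar : ∀ c x : Fin n → X, ε * n < 2 * (hammingDist x c : ℝ) → channelPow W x (D c) ≤ e₂)
    (hp₁ : ∀ c, wordLaw P n {c' | Typical P δ c' ∧ (hammingDist c c' : ℝ) ≤ ε * n} ≤ p₁)
    (hp₂ : ∀ c, Measure.pi (fun _ : Fin n => outputLaw W P) (D c) ≤ p₂)
    (hcost : wordLaw P n {c | ¬ Typical P δ c} + (2 * M : ℕ) * (p₁ + p₂ / L) ≤ η) :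
    ∃ C : ListCode X Y n, C.M = M ∧ C.L = L ∧ C.epsA W ≤ e₁ + 2 * η ∧ C.deltaD W ≤ e₂ ∧
      ∀ m, Typical P δ (C.enc m) := by
  -- The cost has three parts: atypicality, closeness to another typical codeword, and the Markov
  -- bound for list overflow. The first two are indicators, so a cost below 1 rules them out
  -- altogether.
  let b : (Fin n → X) → ℝ≥0∞ := {c | ¬ Typical P δ c}.indicator 1
  let a₁ : (Fin n → X) → (Fin n → X) → ℝ≥0∞ :=
    fun c => {c' | Typical P δ c' ∧ (hammingDist c c' : ℝ) ≤ ε * n}.indicator 1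
  let a₂ : (Fin n → X) → (Fin n → X) → ℝ≥0∞ := fun c c' => channelPow W c (D c') / L
  have hbint : ∫⁻ c, b c ∂wordLaw P n = wordLaw P n {c | ¬ Typical P δ c} :=
    lintegral_indicator_one (Set.toFinite _).measurableSet
  have ha₁ : ∫⁻ c, ∫⁻ c', a₁ c c' ∂wordLaw P n ∂wordLaw P n ≤ p₁ := by
    calc _ ≤ ∫⁻ _c, p₁ ∂wordLaw P n := lintegral_mono fun c =>
          (lintegral_indicator_one (Set.toFinite _).measurableSet).trans_le (hp₁ c)
      _ = p₁ := by simp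
  have ha₂ : ∫⁻ c, ∫⁻ c', a₂ c c' ∂wordLaw P n ∂wordLaw P n ≤ p₂ / L := by
    -- After the swap the tested codeword is fixed and the transmitted one is averaged, which gives
    -- the i.i.d. output law.
    rw [lintegral_lintegral_swap (measurable_of_finite _).aemeasurable]
    calc _ ≤ ∫⁻ _c, p₂ / L ∂wordLaw P n := lintegral_mono fun c' => by
          simp only [a₂, div_eq_mul_inv]
          rw [lintegral_mul_const _ (measurable_of_finite _), lintegral_channelPow]
          gcongr
          exact hp₂ c'
      _ = _ := by simp
  obtain ⟨c, hc⟩ := exists_selection (wordLaw P n) (b := b) (a := fun c c' => a₁ c c' + a₂ c c')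
    (measurable_of_finite _) (measurable_of_finite _) M hη0
    (fun h => by rw [h] at hη; simp at hη) (by
      rw [hbint]
      refine le_trans ?_ hcost
      gcongr
      simp_rw [lintegral_add_left (measurable_of_finite (a₁ _))]
      rw [lintegral_add_left (measurable_of_finite _)]
      exact add_le_add ha₁ ha₂)
  have htyp : ∀ m, Typical P δ (c m) := fun m => by
    by_contra hcon
    have : b (c m) = 1 := Set.indicator_of_mem (s := {c | ¬ Typical P δ c}) hcon 1
    exact absurd hη (not_lt.2 ((this.symm.le.trans le_self_add).trans (hc m)))
  have hdist : ∀ m m', m ≠ m' → ε * n < hammingDist (c m) (c m') := fun m m' hm => by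
    by_contra hcon
    have h1 : a₁ (c m) (c m') = 1 := Set.indicator_of_mem
      (s := {c' | Typical P δ c' ∧ (hammingDist (c m) c' : ℝ) ≤ ε * n})
      ⟨htyp m', not_lt.1 hcon⟩ 1
    have h2 : a₁ (c m) (c m') ≤ 2 * η := by
      refine le_trans ?_ (hc m)
      refine le_trans ?_ le_add_self
      exact le_self_add.trans (Finset.single_le_sum
        (f := fun m' => a₁ (c m) (c m') + a₂ (c m) (c m')) (fun _ _ => zero_le)
        (Finset.mem_erase.2 ⟨hm.symm, Finset.mem_univ m'⟩))
    exact absurd hη (not_lt.2 (h1 ▸ h2))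
  refine ⟨thresholdCode hL hLM c D hD, rfl, rfl, iSup_le fun m => ?_,
    iSup_le fun x => iSup_le fun m => iSup_le fun m' => iSup_le fun hm => ?_, htyp⟩
  · refine (thresholdCode_one_sub_acceptProb_le W m).trans (add_le_add (hown _ (htyp m)) ?_)
    refine le_trans ?_ (hc m)
    exact le_trans (Finset.sum_le_sum fun m' _ => le_add_self) le_add_self
  -- Codewords more than `ε n` apart leave any input at distance more than `ε n / 2` from at least
  -- one of the two.
  · have htri : (hammingDist (c m) (c m') : ℝ) ≤ hammingDist x (c m) + hammingDist x (c m') := by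
      exact_mod_cast hammingDist_triangle_left (c m) (c m') x
    have hd := hdist m m' hm
    rcases lt_or_ge (ε * n) (2 * (hammingDist x (c m) : ℝ)) with h | h
    · exact (min_le_left _ _).trans
        ((thresholdCode_acceptProb_le W m x).trans (hfar _ _ h))
    · exact (min_le_right _ _).trans
        ((thresholdCode_acceptProb_le W m' x).trans (hfar _ _ (by linarith)))

end CodeConstruction

/-! ### Integer code sizes with prescribed exponents. -/

section Rates

/-- The least integer that is at least `exp (n r)`. -/
noncomputable def expCard (r : ℝ) (n : ℕ) : ℕ := ⌈Real.exp (n * r)⌉₊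

theorem exp_le_expCard (r : ℝ) (n : ℕ) : Real.exp (n * r) ≤ expCard r n := Nat.le_ceil _

theorem expCard_pos (r : ℝ) (n : ℕ) : 0 < expCard r n := Nat.ceil_pos.2 (Real.exp_pos _)

theorem expCard_le_two_mul {r : ℝ} (hr : 0 ≤ r) (n : ℕ) :
    (expCard r n : ℝ) ≤ 2 * Real.exp (n * r) := by
  have h1 : 1 ≤ Real.exp (n * r) := Real.one_le_exp (by positivity)
  have h2 := Nat.ceil_lt_add_one (Real.exp_pos (n * r)).le
  unfold expCard
  linarith

theorem eventually_expCard_lt {r s : ℝ} (hr : 0 ≤ r) (hrs : r < s) :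
    ∀ᶠ n : ℕ in atTop, expCard r n < expCard s n := by
  have h : Tendsto (fun n : ℕ => Real.exp (n * (s - r))) atTop atTop :=
    Real.tendsto_exp_atTop.comp (tendsto_natCast_atTop_atTop.atTop_mul_const (sub_pos.2 hrs))
  filter_upwards [h.eventually_gt_atTop 2] with n hn
  have e : Real.exp (n * s) = Real.exp (n * (s - r)) * Real.exp (n * r) := by
    rw [← Real.exp_add]; congr 1; ring
  have : (expCard r n : ℝ) < expCard s n := by
    calc (expCard r n : ℝ) ≤ 2 * Real.exp (n * r) := expCard_le_two_mul hr n
      _ < Real.exp (n * (s - r)) * Real.exp (n * r) := by gcongr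
      _ = Real.exp (n * s) := e.symm
      _ ≤ _ := exp_le_expCard s n
  exact_mod_cast this

theorem tendsto_logb_expCard {R : ℝ} (hR : 0 ≤ R) :
    Tendsto (fun n : ℕ => Real.logb 2 (expCard (R * Real.log 2) n : ℝ) / n) atTop (𝓝 R) := by
  have hl2 : 0 < Real.log 2 := Real.log_pos one_lt_two
  have hlim : Tendsto (fun n : ℕ => R + 1 / (n : ℝ)) atTop (𝓝 R) := by
    simpa using tendsto_const_nhds.add (tendsto_const_div_atTop_nhds_zero_nat (1 : ℝ))
  refine tendsto_of_tendsto_of_tendsto_of_le_of_le' tendsto_const_nhds hlim ?_ ?_ <;>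
  filter_upwards [eventually_gt_atTop 0] with n hn <;>
  have hn' : (0 : ℝ) < n := Nat.cast_pos.2 hn
  · rw [le_div_iff₀ hn', Real.logb, le_div_iff₀ hl2, ← Real.log_exp (R * n * Real.log 2)]
    refine Real.log_le_log (Real.exp_pos _) (le_trans (le_of_eq ?_) (exp_le_expCard _ n))
    congr 1; ring
  · rw [div_le_iff₀ hn', Real.logb, div_le_iff₀ hl2]
    refine (Real.log_le_log (Nat.cast_pos.2 (expCard_pos _ n))
      (expCard_le_two_mul (by positivity) n)).trans (le_of_eq ?_)
    rw [Real.log_mul two_ne_zero (Real.exp_pos _).ne', Real.log_exp]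
    field_simp
    ring

end Rates

/-! ### Choice of constants and existence of good codes. -/

section Asymptotics

variable {X Y : Type*} [Fintype X] [MeasurableSpace Y] (W : X → Measure Y)
  [∀ x, IsProbabilityMeasure (W x)]

/-- Markov's inequality for a product of likelihood ratios. -/
theorem pi_outputLaw_lt_sum_le {P : PMF X} {g : X → Y → ℝ} (hg : ∀ x, Measurable (g x))
    (hg1 : ∀ x, ∫⁻ y, ENNReal.ofReal (Real.exp (g x y)) ∂outputLaw W P ≤ 1) {n : ℕ}
    (c : Fin n → X) (a : ℝ) :
    Measure.pi (fun _ : Fin n => outputLaw W P) {y | a < ∑ i, g (c i) (y i)} ≤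
      ENNReal.ofReal (Real.exp (-a)) := by
  have hm : ∀ i, Measurable fun y => ENNReal.ofReal (Real.exp (g (c i) y)) := fun i =>
    (Real.measurable_exp.comp (hg (c i))).ennreal_ofReal
  calc _ ≤ Measure.pi (fun _ : Fin n => outputLaw W P)
        {y | ENNReal.ofReal (Real.exp a) ≤ ∏ i, ENNReal.ofReal (Real.exp (g (c i) (y i)))} := by
        refine measure_mono fun y hy => ?_
        simp only [Set.mem_ofPred_eq] at hy ⊢
        rw [← ENNReal.ofReal_prod_of_nonneg fun i _ => (Real.exp_pos _).le, ← Real.exp_sum]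
        exact ENNReal.ofReal_le_ofReal (Real.exp_le_exp.2 hy.le)
    _ ≤ (∫⁻ y, ∏ i, ENNReal.ofReal (Real.exp (g (c i) (y i)))
          ∂Measure.pi (fun _ : Fin n => outputLaw W P)) / ENNReal.ofReal (Real.exp a) :=
        meas_ge_le_lintegral_div (measurable_prod_eval hm).aemeasurable
          (by simpa using Real.exp_pos a) ENNReal.ofReal_ne_top
    _ ≤ 1 / ENNReal.ofReal (Real.exp a) := by
        gcongr
        rw [lintegral_pi_prod _ (fun i y => ENNReal.ofReal (Real.exp (g (c i) y))) hm]
        exact Finset.prod_le_one' fun i _ => hg1 (c i)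
    _ = _ := by
        rw [one_div, ← ENNReal.ofReal_inv_of_pos (Real.exp_pos a), Real.exp_neg]

theorem tendsto_chebyshev_bound (B : ℝ) {s : ℝ} (hs : 0 < s) :
    Tendsto (fun n : ℕ => (Fintype.card (Fin n) : ℝ) * B ^ 2 / (n * s) ^ 2) atTop (𝓝 0) := by
  refine (tendsto_const_div_atTop_nhds_zero_nat (B ^ 2 / s ^ 2)).congr' ?_
  filter_upwards [eventually_gt_atTop 0] with n hn
  have hn' : (n : ℝ) ≠ 0 := (Nat.cast_pos.2 hn).ne'
  rw [Fintype.card_fin]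
  field_simp

/-- Each rate gap is `4 κ`; the estimates spend `3 κ`, and the last `κ` is the exponential decay. -/
theorem expCard_mul_add_le {r₁ r₂ H I κ : ℝ} (hr₁ : 0 ≤ r₁) (hH : r₁ + 4 * κ ≤ H)
    (hI : r₁ - r₂ + 4 * κ ≤ I) (n : ℕ) :
    2 * (expCard r₁ n : ℝ) * (Real.exp (n * (-H + 3 * κ)) +
      Real.exp (-(n * (I - 3 * κ))) / expCard r₂ n) ≤ 8 * Real.exp (-(κ * n)) := by
  have hn : (0 : ℝ) ≤ n := Nat.cast_nonneg n
  have h1 : Real.exp (-(n * (I - 3 * κ))) / expCard r₂ n ≤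
      Real.exp (-(n * (I - 3 * κ)) - n * r₂) := by
    rw [Real.exp_sub]
    exact div_le_div_of_nonneg_left (Real.exp_pos _).le (Real.exp_pos _) (exp_le_expCard r₂ n)
  calc _ ≤ 2 * (2 * Real.exp (n * r₁)) * (Real.exp (n * (-H + 3 * κ)) +
        Real.exp (-(n * (I - 3 * κ)) - n * r₂)) := by
        gcongr
        exact expCard_le_two_mul hr₁ n
    _ = 4 * (Real.exp (n * r₁ + n * (-H + 3 * κ)) +
        Real.exp (n * r₁ + (-(n * (I - 3 * κ)) - n * r₂))) := by
        rw [Real.exp_add, Real.exp_add]; ring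
    _ ≤ 4 * (Real.exp (-(κ * n)) + Real.exp (-(κ * n))) := by
        gcongr <;> nlinarith
    _ = _ := by ring

theorem inputEntropy_mul_log_two (P : PMF X) :
    inputEntropy P * Real.log 2 = -∑ x, (P x).toReal * Real.log (P x).toReal := by
  have hl2 : Real.log 2 ≠ 0 := (Real.log_pos one_lt_two).ne'
  rw [inputEntropy, Finset.sum_mul, ← Finset.sum_neg_distrib]
  refine Finset.sum_congr rfl fun x _ => ?_
  rw [Real.logb]
  field_simp

variable {W} [DecidableEq X] [MeasurableSpace X] [MeasurableSingletonClass X]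

theorem eventually_exists_listCode (hW : NonRedundant W) {P : PMF X} {R₁ R₂ δ : ℝ}
    (hR₂ : 0 ≤ R₂) (hR : R₂ < R₁) (hI : R₁ - R₂ < (mutualInfo W P).toReal)
    (hH : R₁ < inputEntropy P) (hδ : 0 < δ) :
    ∀ᶠ n : ℕ in atTop, ∃ C : ListCode X Y n, C.M = expCard (R₁ * Real.log 2) n ∧
      C.L = expCard (R₂ * Real.log 2) n ∧ C.epsA W ≤ ENNReal.ofReal δ ∧
      C.deltaD W ≤ ENNReal.ofReal δ ∧ ∀ m, Typical P δ (C.enc m) := by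
  have hl2 : 0 < Real.log 2 := Real.log_pos one_lt_two
  set r₁ := R₁ * Real.log 2 with hr₁
  set r₂ := R₂ * Real.log 2 with hr₂
  set I := Real.log 2 * (mutualInfo W P).toReal with hIdef
  set H := inputEntropy P * Real.log 2 with hHdef
  have hr₂0 : 0 ≤ r₂ := by positivity
  have hr₂₁ : r₂ < r₁ := mul_lt_mul_of_pos_right hR hl2
  obtain ⟨κ, hκ, hκH, hκI⟩ : ∃ κ : ℝ, 0 < κ ∧ r₁ + 4 * κ ≤ H ∧ r₁ - r₂ + 4 * κ ≤ I := by
    have h1 : r₁ < H := mul_lt_mul_of_pos_right hH hl2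
    have h2 : r₁ - r₂ < I := by rw [hr₁, hr₂, hIdef]; nlinarith
    refine ⟨min (H - r₁) (I - (r₁ - r₂)) / 4, by
      have : 0 < min (H - r₁) (I - (r₁ - r₂)) := lt_min (by linarith) (by linarith)
      linarith, ?_, ?_⟩
    · linarith [min_le_left (H - r₁) (I - (r₁ - r₂))]
    · linarith [min_le_right (H - r₁) (I - (r₁ - r₂))]
  obtain ⟨g, Bg, hgm, hgB, hg1, hgI⟩ := exists_information_density W P hκ
  obtain ⟨ξ, Bξ, ζ, hζ, hξm, hξB, hξ0, hξζ⟩ := hW.exists_test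
  have hexists : ∀ K : ℝ, 0 ≤ K → ∃ t : ℝ, 0 < t ∧ t ≤ 1 ∧ t * K ≤ κ := by
    intro K hK
    refine ⟨min 1 (κ / (K + 1)), by positivity, min_le_left _ _, ?_⟩
    calc min 1 (κ / (K + 1)) * K ≤ κ / (K + 1) * K := by gcongr; exact min_le_right _ _
      _ = κ * (K / (K + 1)) := by ring
      _ ≤ κ * 1 := by gcongr; exact div_le_one_of_le₀ (by linarith) (by linarith)
      _ = κ := mul_one _
  -- The order matters: `t` first makes the term `|X| t` of the ball size small, then `ε` is chosen
  -- against the now fixed `log (1 / t)`.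
  obtain ⟨t, ht, ht1, htκ⟩ := hexists (Fintype.card X) (Nat.cast_nonneg _)
  obtain ⟨ε, hε, -, hεκ⟩ := hexists (Real.log (1 / t))
    (Real.log_nonneg (by rw [le_div_iff₀ ht]; linarith))
  set K : ℝ := ∑ x, |Real.log (P x).toReal| + ∑ x, |∫ y, g x y ∂W x| with hK
  have hK1 : 0 ≤ ∑ x, |Real.log (P x).toReal| := Finset.sum_nonneg fun _ _ => abs_nonneg _
  have hK2 : 0 ≤ ∑ x, |∫ y, g x y ∂W x| := Finset.sum_nonneg fun _ _ => abs_nonneg _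
  obtain ⟨δ', hδ'0, hδ', hδK⟩ : ∃ δ' : ℝ, 0 < δ' ∧ δ' ≤ δ ∧ δ' * K ≤ κ := by
    obtain ⟨s, hs, -, hsκ⟩ := hexists K (by positivity)
    refine ⟨min s δ, lt_min hs hδ, min_le_right _ _, le_trans ?_ hsκ⟩
    gcongr
    exact min_le_left _ _
  -- The threshold lies halfway between the mean 0 for the true codeword and the bound `-ζ ε n / 2 =
  -- -2 β n` for an input at distance more than `ε n / 2`.
  set β : ℝ := ζ * ε / 4 with hβ
  have hβ0 : 0 < β := by positivity
  -- The bound `1 / 4` gives `2 η < 1` for expurgation; `δ / 4` leaves room for the two Chebyshev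
  -- errors.
  set η : ℝ := min (δ / 4) (1 / 4) with hη
  have hη0 : 0 < η := by positivity
  have hcost : Tendsto (fun n : ℕ => Fintype.card X * (2 * (1 / (n * δ' ^ 2))) +
      8 * Real.exp (-(κ * n))) atTop (𝓝 ((Fintype.card X : ℝ) * (2 * 0) + 8 * 0)) := by
    refine Tendsto.add (Tendsto.const_mul _ (Tendsto.const_mul _ ?_)) (Tendsto.const_mul _ ?_)
    · refine (tendsto_const_div_atTop_nhds_zero_nat (1 / δ' ^ 2)).congr fun n => ?_
      rw [div_div, mul_comm]
    · exact Real.tendsto_exp_neg_atTop_nhds_zero.comp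
        (tendsto_natCast_atTop_atTop.const_mul_atTop hκ)
  simp only [mul_zero, add_zero] at hcost
  filter_upwards [eventually_expCard_lt hr₂0 hr₂₁, eventually_gt_atTop 0,
    hcost.eventually_le_const hη0,
    (tendsto_chebyshev_bound Bg hκ).eventually_le_const (show 0 < δ / 4 by positivity),
    (tendsto_chebyshev_bound Bξ hβ0).eventually_le_const (show 0 < δ / 4 by positivity)]
    with n hLM hn hcost hBg hBξ
  have hn' : (0 : ℝ) < n := Nat.cast_pos.2 hn
  -- The `3 κ` below `I` pays for the bounded density, for the letter frequencies and for the
  -- Chebyshev deviation.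
  let D : (Fin n → X) → Set (Fin n → Y) := fun c =>
    {y | n * (I - 3 * κ) < ∑ i, g (c i) (y i)} ∩ {y | -(n * β) < ∑ i, ξ (c i) (y i)}
  have hsm : ∀ (f : X → Y → ℝ) (_ : ∀ x, Measurable (f x)) (c : Fin n → X),
      Measurable fun y : Fin n → Y => ∑ i, f (c i) (y i) := fun f hf c =>
    Finset.measurable_fun_sum _ fun i _ => (hf (c i)).comp (measurable_pi_apply i)
  have hD : ∀ c, MeasurableSet (D c) := fun c =>
    (measurableSet_lt measurable_const (hsm g hgm c)).inter
      (measurableSet_lt measurable_const (hsm ξ hξm c))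
  obtain ⟨C, hM, hL, hA, hδD, htyp⟩ := exists_listCode W (expCard_pos r₂ n) hLM P hD
    (δ := δ') (ε := ε) (e₁ := ENNReal.ofReal (δ / 4) + ENNReal.ofReal (δ / 4))
    (e₂ := ENNReal.ofReal (δ / 4))
    (p₁ := ENNReal.ofReal (Real.exp (n * (-H + 3 * κ))))
    (p₂ := ENNReal.ofReal (Real.exp (-(n * (I - 3 * κ))))) (η := ENNReal.ofReal η)
    (by simpa using hη0)
    (by
      rw [← ENNReal.ofReal_ofNat, ← ENNReal.ofReal_mul zero_le_two, ENNReal.ofReal_lt_one]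
      linarith [min_le_right (δ / 4) (1 / 4)])
    (by
      intro c hc
      rw [Set.compl_inter]
      refine (measure_union_le _ _).trans (add_le_add ?_ ?_)
      · refine le_trans (measure_mono fun y hy => ?_)
          ((pi_sum_le_mean_sub (fun i => W (c i)) (fun i => hgm (c i)) (fun i => hgB (c i))
            (mul_pos hn' hκ)).trans (ENNReal.ofReal_le_ofReal hBg))
        have h1 := (abs_le.1 (hc.abs_sum_sub_le fun x => ∫ y, g x y ∂W x)).1
        simp only [Set.mem_compl_iff, Set.mem_ofPred_eq, not_lt] at hy ⊢
        have h2 : δ' * ∑ x, |∫ y, g x y ∂W x| ≤ κ := by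
          refine le_trans ?_ hδK
          gcongr
          linarith
        nlinarith [mul_le_mul_of_nonneg_left h2 hn'.le, mul_le_mul_of_nonneg_left hgI hn'.le]
      · refine le_trans (measure_mono fun y hy => ?_)
          ((pi_sum_le_mean_sub (fun i => W (c i)) (fun i => hξm (c i)) (fun i => hξB (c i))
            (mul_pos hn' hβ0)).trans (ENNReal.ofReal_le_ofReal hBξ))
        simp only [Set.mem_compl_iff, Set.mem_ofPred_eq, not_lt, hξ0, Finset.sum_const_zero,
          zero_sub] at hy ⊢
        exact hy)
    (by
      intro c x hcx
      refine le_trans (measure_mono fun y hy => ?_)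
        ((pi_mean_add_le_sum (fun i => W (x i)) (fun i => hξm (c i)) (fun i => hξB (c i))
          (mul_pos hn' hβ0)).trans (ENNReal.ofReal_le_ofReal hBξ))
      have h1 : ∑ i, ∫ y, ξ (c i) y ∂W (x i) ≤ hammingDist x c * (-ζ) := by
        calc _ ≤ ∑ i, if x i ≠ c i then -ζ else 0 := Finset.sum_le_sum fun i _ => by
              split_ifs with h
              · exact hξζ _ _ h
              · rw [not_not.1 h, hξ0]
          _ = _ := by rw [← Finset.sum_filter, Finset.sum_const, nsmul_eq_mul]; rfl
      have h2 := hy.2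
      simp only [Set.mem_ofPred_eq] at h2 ⊢
      have h3 := mul_lt_mul_of_pos_left hcx hζ
      rw [hβ] at h2 ⊢
      nlinarith)
    (by
      intro c
      refine (wordLaw_typical_close_le P ht ht1 c).trans
        (ENNReal.ofReal_le_ofReal (Real.exp_le_exp.2 ?_))
      have h1 : δ' * ∑ x, |Real.log (P x).toReal| ≤ κ := by
        refine le_trans ?_ hδK
        gcongr
        linarith
      have h2 := inputEntropy_mul_log_two P
      exact mul_le_mul_of_nonneg_left (by linarith) hn'.le)
    (fun c => (measure_mono Set.inter_subset_left).trans
      (pi_outputLaw_lt_sum_le W hgm hg1 c _))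
    (by
      refine (add_le_add_left (wordLaw_not_typical_le P hδ'0 hn) _).trans ?_
      refine le_trans (le_of_eq ?_) (ENNReal.ofReal_le_ofReal ((add_le_add_right
        (expCard_mul_add_le (hr₂0.trans hr₂₁.le) hκH hκI n) _).trans hcost))
      have hL0 : (0 : ℝ) < expCard r₂ n := Nat.cast_pos.2 (expCard_pos _ _)
      rw [ENNReal.ofReal_add (by positivity) (by positivity), ENNReal.ofReal_mul (by positivity),
        ENNReal.ofReal_mul (by positivity), ENNReal.ofReal_mul (by positivity),
        ENNReal.ofReal_mul (by positivity), ENNReal.ofReal_add (by positivity) (by positivity),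
        ENNReal.ofReal_div_of_pos hL0]
      simp)
  refine ⟨C, hM, hL, hA.trans ?_, hδD.trans (ENNReal.ofReal_le_ofReal (by linarith)),
    fun m => (htyp m).mono hδ'⟩
  rw [← ENNReal.ofReal_ofNat, ← ENNReal.ofReal_mul zero_le_two, ← ENNReal.ofReal_add
    (by positivity) (by positivity), ← ENNReal.ofReal_add (by positivity) (by positivity)]
  exact ENNReal.ofReal_le_ofReal (by linarith [min_le_left (δ / 4) (1 / 4)])

end Asymptotics

/-! ### Rényi moments of joint laws. -/

section JointLaw

variable {X Y : Type*} [Fintype X] [MeasurableSpace X] [MeasurableSpace Y]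

theorem lintegral_jointLaw (P : PMF X) (V : X → Measure Y) [∀ x, IsProbabilityMeasure (V x)]
    {f : X × Y → ℝ≥0∞} (hf : Measurable f) :
    ∫⁻ z, f z ∂jointLaw P V = ∑ x, P x * ∫⁻ y, f (x, y) ∂V x := by
  rw [jointLaw, lintegral_finsetSum_measure]
  refine Finset.sum_congr rfl fun x _ => ?_
  rw [lintegral_smul_measure, Measure.dirac_prod, lintegral_map hf measurable_prodMk_left,
    smul_eq_mul]

instance (P : PMF X) (V : X → Measure Y) [∀ x, IsProbabilityMeasure (V x)] :
    IsProbabilityMeasure (jointLaw P V) :=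
  ⟨by simp [jointLaw, sum_pmf]⟩

variable [MeasurableSingletonClass X]

/-- The joint Rényi moment determines the conditional ones. -/
theorem renyiMoment_jointLaw {W : X → Measure Y} [∀ x, IsProbabilityMeasure (W x)] {P : PMF X}
    {Q : Measure Y} [IsProbabilityMeasure Q] (α : ℝ)
    (hac : jointLaw P W ≪ jointLaw P fun _ => Q) :
    (∀ x, P x ≠ 0 → W x ≪ Q) ∧
      renyiMoment α (jointLaw P W) (jointLaw P fun _ => Q) = ∑ x, P x * renyiMoment α (W x) Q := by
  classical
  set F := (jointLaw P W).rnDeriv (jointLaw P fun _ => Q) with hF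
  have hFm : Measurable F := Measure.measurable_rnDeriv _ _
  have hFx : ∀ x, Measurable fun y => F (x, y) := fun x => hFm.comp measurable_prodMk_left
  have hsingle : ∀ (V : X → Measure Y) [∀ x, IsProbabilityMeasure (V x)] (f : X × Y → ℝ≥0∞)
      (_ : Measurable f) (x : X) (B : Set Y) (_ : MeasurableSet B),
      ∫⁻ z in {x} ×ˢ B, f z ∂jointLaw P V = P x * ∫⁻ y in B, f (x, y) ∂V x := by
    intro V _ f hf x B hB
    have hS : MeasurableSet ({x} ×ˢ B : Set (X × Y)) := (measurableSet_singleton x).prod hB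
    rw [← lintegral_indicator hS, lintegral_jointLaw P V (hf.indicator hS),
      Finset.sum_eq_single x]
    · rw [← lintegral_indicator hB]
      congr 2
      ext y
      by_cases hy : y ∈ B <;> simp [hy]
    · intro z _ hz
      simp [hz]
    · simp
  -- On the slice over `x` both joint laws carry the factor `P x`, which cancels; the joint density
  -- therefore restricts to the conditional one.
  have hW : ∀ x, P x ≠ 0 → W x = Q.withDensity fun y => F (x, y) := by
    intro x hx
    refine Measure.ext fun B hB => ?_
    have h1 := hsingle W (fun _ => 1) measurable_const x B hB
    have h2 := hsingle (fun _ => Q) F hFm x B hB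
    rw [setLIntegral_one, setLIntegral_one] at h1
    rw [hF, Measure.setLIntegral_rnDeriv hac, h1, ← hF] at h2
    rw [withDensity_apply _ hB]
    exact (ENNReal.mul_right_inj hx (P.apply_ne_top x)).1 h2
  have hacx : ∀ x, P x ≠ 0 → W x ≪ Q := fun x hx => by
    rw [hW x hx]; exact withDensity_absolutelyContinuous _ _
  refine ⟨hacx, ?_⟩
  rw [renyiMoment, if_pos hac, lintegral_jointLaw P W (hFm.pow_const _)]
  refine Finset.sum_congr rfl fun x _ => ?_
  by_cases hx : P x = 0
  · simp [hx]
  · have hD : (W x).rnDeriv Q =ᵐ[Q] fun y => F (x, y) := by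
      conv_lhs => rw [hW x hx]
      exact Measure.rnDeriv_withDensity _ (hFx x)
    rw [renyiMoment, if_pos (hacx x hx)]
    congr 1
    refine lintegral_congr_ae ?_
    filter_upwards [(hacx x hx).ae_le hD] with y hy
    rw [hy]

end JointLaw

theorem renyiMoment_ne_zero {Ω : Type*} [MeasurableSpace Ω] {P Q : Measure Ω}
    [IsProbabilityMeasure P] [IsProbabilityMeasure Q] {α : ℝ} (hα : 1 < α) :
    renyiMoment α P Q ≠ 0 := by
  rw [renyiMoment]
  split_ifs with h
  · rw [Ne, lintegral_eq_zero_iff ((Measure.measurable_rnDeriv _ _).pow_const _)]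
    intro h0
    have hf : ∀ᵐ _y ∂P, False := by
      filter_upwards [h0, Measure.rnDeriv_pos h] with y h1 h2
      rw [Pi.zero_apply, ENNReal.rpow_eq_zero_iff_of_pos (by linarith)] at h1
      exact h2.ne' h1
    rw [eventually_false_iff_eq_bot, ae_eq_bot] at hf
    exact IsProbabilityMeasure.ne_zero P hf
  · exact ENNReal.top_ne_zero

theorem log2_ofReal_exp (r : ℝ) :
    log2 (ENNReal.ofReal (Real.exp r)) = ((r / Real.log 2 : ℝ) : EReal) := by
  rw [log2, ENNReal.log_ofReal_of_pos (Real.exp_pos r), Real.log_exp, ← EReal.coe_div]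

theorem log2_mono {a b : ℝ≥0∞} (h : a ≤ b) : log2 a ≤ log2 b :=
  EReal.div_le_div_right_of_nonneg (by exact_mod_cast (Real.log_pos one_lt_two).le)
    (ENNReal.log_le_log h)

theorem log2_top : log2 ∞ = ⊤ := by
  rw [log2, ENNReal.log_top]
  exact EReal.top_div_of_pos_ne_top (by exact_mod_cast Real.log_pos one_lt_two)
    (EReal.coe_ne_top _)

theorem sum_div_card_le {M : ℕ} (hM : 0 < M) {f : Fin M → ℝ≥0∞} {b : ℝ≥0∞} (h : ∀ m, f m ≤ b) :
    (∑ m, f m) / (M : ℝ≥0∞) ≤ b := by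
  have hM0 : (M : ℝ≥0∞) ≠ 0 := by exact_mod_cast hM.ne'
  refine ENNReal.div_le_of_le_mul ((Finset.sum_le_sum fun m _ => h m).trans ?_)
  simp [mul_comm]

/-- A finite joint divergence forces absolute continuity and finite moments on the support of `P`,
so the rest of the argument can use positive real numbers. -/
theorem exists_moments_of_renyiDiv_lt {X Y : Type*} [Fintype X] [MeasurableSpace X]
    [MeasurableSingletonClass X] [MeasurableSpace Y] {W : X → Measure Y}
    [∀ x, IsProbabilityMeasure (W x)] {P : PMF X}
    {Q : Measure Y} [IsProbabilityMeasure Q] {α : ℝ} (hα : 1 < α) {s : ℝ}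
    (h : renyiDiv α (jointLaw P W) (jointLaw P fun _ => Q) < (s : EReal)) :
    ∃ m : X → ℝ, (∀ x, 0 < m x) ∧ (∀ x, P x ≠ 0 → W x ≪ Q) ∧
      (∀ x, P x ≠ 0 → renyiMoment α (W x) Q = ENNReal.ofReal (m x)) ∧
      Real.log (∑ x, (P x).toReal * m x) / Real.log 2 / (α - 1) < s := by
  have hα' : (0 : EReal) < ((α - 1 : ℝ) : EReal) := by exact_mod_cast sub_pos.2 hα
  have hne : renyiMoment α (jointLaw P W) (jointLaw P fun _ => Q) ≠ ∞ := by
    intro htop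
    rw [renyiDiv, htop, log2_top, EReal.top_div_of_pos_ne_top hα' (EReal.coe_ne_top _)] at h
    exact not_top_lt h
  have hac : jointLaw P W ≪ jointLaw P fun _ => Q := by
    by_contra hcon
    exact hne (by rw [renyiMoment, if_neg hcon])
  obtain ⟨hacx, hmom⟩ := renyiMoment_jointLaw α hac
  have hfin : ∀ x, P x ≠ 0 → renyiMoment α (W x) Q ≠ ∞ := fun x hx htop => by
    rw [hmom] at hne
    have := ENNReal.sum_ne_top.1 hne x (Finset.mem_univ x)
    rw [htop, ENNReal.mul_top hx] at this
    exact this rfl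
  let m : X → ℝ := fun x => if P x = 0 then 1 else (renyiMoment α (W x) Q).toReal
  have hm : ∀ x, 0 < m x := fun x => by
    simp only [m]
    split_ifs with hx
    · exact one_pos
    · exact ENNReal.toReal_pos (renyiMoment_ne_zero hα) (hfin x hx)
  have hmm : ∀ x, P x ≠ 0 → renyiMoment α (W x) Q = ENNReal.ofReal (m x) := fun x hx => by
    simp only [m, if_neg hx, ENNReal.ofReal_toReal (hfin x hx)]
  have hsum : renyiMoment α (jointLaw P W) (jointLaw P fun _ => Q)
      = ENNReal.ofReal (∑ x, (P x).toReal * m x) := by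
    rw [hmom, ENNReal.ofReal_sum_of_nonneg fun x _ =>
      mul_nonneg ENNReal.toReal_nonneg (hm x).le]
    refine Finset.sum_congr rfl fun x _ => ?_
    rw [ENNReal.ofReal_mul ENNReal.toReal_nonneg, ENNReal.ofReal_toReal (P.apply_ne_top x)]
    by_cases hx : P x = 0
    · simp [hx]
    · rw [hmm x hx]
  have hpos : 0 < ∑ x, (P x).toReal * m x := by
    have h0 : renyiMoment α (jointLaw P W) (jointLaw P fun _ => Q) ≠ 0 := renyiMoment_ne_zero hα
    rw [hsum] at h0
    exact ENNReal.ofReal_pos.1 (pos_iff_ne_zero.2 h0)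
  refine ⟨m, hm, hacx, hmm, ?_⟩
  rw [renyiDiv, hsum, ← Real.exp_log hpos, log2_ofReal_exp, ← EReal.coe_div] at h
  exact_mod_cast h

/-! ### Equivocation of codes with typical codewords. -/

section Equivocation

variable {X Y : Type*} [Fintype X] [DecidableEq X] [MeasurableSpace Y] {W : X → Measure Y}
  [∀ x, IsProbabilityMeasure (W x)] {P : PMF X} {n : ℕ} {δ : ℝ}

theorem ListCode.M_pos {X : Type*} (C : ListCode X Y n) : 0 < C.M := C.L_pos.trans C.L_lt_M

theorem Typical.klDiv2_channelPow_le {c : Fin n → X} (hc : Typical P δ c) :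
    klDiv2 (channelPow W c) (Measure.pi fun _ => outputLaw W P) ≤
      ENNReal.ofReal (n * ((mutualInfo W P).toReal +
        δ * ∑ x, |(klDiv2 (W x) (outputLaw W P)).toReal|)) := by
  have hne : ∀ i, InformationTheory.klDiv (W (c i)) (outputLaw W P) ≠ ∞ :=
    fun i => klDiv_outputLaw_ne_top (hc.1 i)
  have hne2 : ∀ i, klDiv2 (W (c i)) (outputLaw W P) ≠ ∞ :=
    fun i => ENNReal.div_ne_top (hne i) ofReal_log_two_ne_zero
  have h1 : klDiv2 (channelPow W c) (Measure.pi fun _ => outputLaw W P)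
      = ENNReal.ofReal (∑ i, (klDiv2 (W (c i)) (outputLaw W P)).toReal) := by
    rw [klDiv2, channelPow, klDiv_pi hne, ← ENNReal.toReal_sum fun i _ => hne2 i,
      ENNReal.ofReal_toReal (ENNReal.sum_ne_top.2 fun i _ => hne2 i)]
    simp only [klDiv2, div_eq_mul_inv]
    rw [Finset.sum_mul]
  rw [h1]
  refine ENNReal.ofReal_le_ofReal ?_
  have := (abs_le.1 (hc.abs_sum_sub_le fun x => (klDiv2 (W x) (outputLaw W P)).toReal)).2
  rw [toReal_mutualInfo]
  linarith

theorem le_equivocation {C : ListCode X Y n} (hC : ∀ m, Typical P δ (C.enc m)) (hδ : 0 ≤ δ) :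
    ((Real.logb 2 C.M - n * ((mutualInfo W P).toReal +
      δ * ∑ x, |(klDiv2 (W x) (outputLaw W P)).toReal|) : ℝ) : EReal) ≤ C.equivocation W := by
  rw [ListCode.equivocation, EReal.coe_sub]
  refine EReal.sub_le_sub le_rfl ?_
  have hK : 0 ≤ ∑ x, |(klDiv2 (W x) (outputLaw W P)).toReal| :=
    Finset.sum_nonneg fun _ _ => abs_nonneg _
  have hI : 0 ≤ (mutualInfo W P).toReal := ENNReal.toReal_nonneg
  rw [← max_eq_left (a := (n * ((mutualInfo W P).toReal +
      δ * ∑ x, |(klDiv2 (W x) (outputLaw W P)).toReal|) : ℝ)) (b := 0) (by positivity),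
    ← EReal.coe_ennreal_ofReal, EReal.coe_ennreal_le_coe_ennreal_iff]
  exact iInf_le_of_le ⟨Measure.pi fun _ => outputLaw W P, inferInstance⟩
    (sum_div_card_le C.M_pos fun m => (hC m).klDiv2_channelPow_le)

/-- Along a typical word the log-moment is about `n ∑ P(x) log m(x)`, which Jensen's inequality
bounds by `n` times the log of the joint moment. -/
theorem Typical.renyiMoment_channelPow_le {c : Fin n → X} (hc : Typical P δ c) {Q : Measure Y}
    [IsProbabilityMeasure Q] {α : ℝ} (hα : 1 < α) {m : X → ℝ} (hm : ∀ x, 0 < m x)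
    (hac : ∀ x, P x ≠ 0 → W x ≪ Q)
    (hmom : ∀ x, P x ≠ 0 → renyiMoment α (W x) Q = ENNReal.ofReal (m x)) :
    renyiMoment α (channelPow W c) (Measure.pi fun _ => Q) ≤
      ENNReal.ofReal (Real.exp (n * (Real.log (∑ x, (P x).toReal * m x) +
        δ * ∑ x, |Real.log (m x)|))) := by
  rw [channelPow, renyiMoment_pi (fun i => hac _ (hc.1 i)) hα]
  have h1 : ∏ i, renyiMoment α (W (c i)) Q
      = ENNReal.ofReal (Real.exp (∑ i, Real.log (m (c i)))) := by
    rw [Real.exp_sum, ENNReal.ofReal_prod_of_nonneg fun i _ => (Real.exp_pos _).le]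
    refine Finset.prod_congr rfl fun i _ => ?_
    rw [Real.exp_log (hm _), hmom _ (hc.1 i)]
  rw [h1]
  refine ENNReal.ofReal_le_ofReal (Real.exp_le_exp.2 ?_)
  have h2 := (abs_le.1 (hc.abs_sum_sub_le fun x => Real.log (m x))).2
  have h3 : ∑ x, (P x).toReal * Real.log (m x) ≤ Real.log (∑ x, (P x).toReal * m x) :=
    strictConcaveOn_log_Ioi.concaveOn.le_map_sum (t := Finset.univ)
      (fun x _ => ENNReal.toReal_nonneg) (sum_toReal_pmf P) fun x _ => hm x
  nlinarith [mul_le_mul_of_nonneg_left h3 (Nat.cast_nonneg (α := ℝ) n)]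

theorem le_renyiEquivocation {C : ListCode X Y n} (hC : ∀ m, Typical P δ (C.enc m))
    {Q : Measure Y} [IsProbabilityMeasure Q] {α : ℝ} (hα : 1 < α) {m : X → ℝ}
    (hm : ∀ x, 0 < m x) (hac : ∀ x, P x ≠ 0 → W x ≪ Q)
    (hmom : ∀ x, P x ≠ 0 → renyiMoment α (W x) Q = ENNReal.ofReal (m x)) :
    ((Real.logb 2 C.M - n * (Real.log (∑ x, (P x).toReal * m x) +
      δ * ∑ x, |Real.log (m x)|) / Real.log 2 / (α - 1) : ℝ) : EReal) ≤
        C.renyiEquivocation α W := by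
  rw [ListCode.renyiEquivocation, EReal.coe_sub]
  refine EReal.sub_le_sub le_rfl (iInf_le_of_le ⟨Measure.pi fun _ => Q, inferInstance⟩ ?_)
  rw [EReal.coe_div, ← log2_ofReal_exp]
  exact EReal.div_le_div_right_of_nonneg (by exact_mod_cast (sub_pos.2 hα).le)
    (log2_mono (sum_div_card_le C.M_pos fun k => (hC k).renyiMoment_channelPow_le hα hm hac hmom))

end Equivocation

/-! ### Diagonal code sequences and achievability. -/

section Achievability

/-- Take the largest `k ≤ n` for which `p k n` holds. The search defaults to 0, which is harmless
once `p 0 n` holds. -/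
theorem exists_diagonal {p : ℕ → ℕ → Prop} (h : ∀ k, ∀ᶠ n in atTop, p k n) :
    ∃ κ : ℕ → ℕ, Tendsto κ atTop atTop ∧ ∀ᶠ n in atTop, p (κ n) n := by
  classical
  refine ⟨fun n => Nat.findGreatest (fun k => p k n) n, tendsto_atTop.2 fun k => ?_, ?_⟩
  · filter_upwards [h k, eventually_ge_atTop k] with n h1 h2
    exact Nat.le_findGreatest h2 h1
  · filter_upwards [h 0] with n hn
    exact Nat.findGreatest_spec (P := fun k => p k n) (Nat.zero_le n) hn

theorem le_liminf_div_of_tendsto {u : ℕ → EReal} {v : ℕ → ℝ} {r : ℝ}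
    (h : ∀ᶠ n in atTop, ((v n : ℝ) : EReal) ≤ u n)
    (hv : Tendsto (fun n : ℕ => v n / n) atTop (𝓝 r)) :
    (r : EReal) ≤ liminf (fun n : ℕ => u n / (n : EReal)) atTop := by
  rw [← ((continuous_coe_real_ereal.tendsto r).comp hv).liminf_eq]
  refine liminf_le_liminf ?_
  filter_upwards [h] with n hn
  rw [Function.comp_apply, EReal.coe_div, EReal.coe_natCast]
  exact EReal.div_le_div_right_of_nonneg (by exact_mod_cast n.zero_le) hn

variable {X Y : Type*} [Fintype X] [DecidableEq X] [MeasurableSpace X]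
  [MeasurableSingletonClass X] [MeasurableSpace Y] {W : X → Measure Y}
  [∀ x, IsProbabilityMeasure (W x)]

theorem exists_secure_typical_codes (hW : NonRedundant W) {P : PMF X} {R₁ R₂ : ℝ} (hR₂ : 0 ≤ R₂)
    (hR : R₂ < R₁) (hI : R₁ - R₂ < (mutualInfo W P).toReal) (hH : R₁ < inputEntropy P) :
    ∃ (C : ∀ n, ListCode X Y n) (δ : ℕ → ℝ), StronglySecure W C ∧ HasRates C R₁ R₂ ∧
      Tendsto δ atTop (𝓝 0) ∧ (∀ n, 0 ≤ δ n) ∧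
      ∀ᶠ n in atTop, ∀ m, Typical P (δ n) ((C n).enc m) := by
  let good : ℕ → ∀ n, ListCode X Y n → Prop := fun k n C =>
    C.M = expCard (R₁ * Real.log 2) n ∧ C.L = expCard (R₂ * Real.log 2) n ∧
      C.epsA W ≤ ENNReal.ofReal (1 / ((k : ℝ) + 1)) ∧
      C.deltaD W ≤ ENNReal.ofReal (1 / ((k : ℝ) + 1)) ∧
      ∀ m, Typical P (1 / ((k : ℝ) + 1)) (C.enc m)
  obtain ⟨κ, hκ, hgood⟩ := exists_diagonal (p := fun k n => ∃ C, good k n C) fun k =>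
    eventually_exists_listCode hW hR₂ hR hI hH (by positivity : 0 < 1 / ((k : ℝ) + 1))
  obtain ⟨x₀, -⟩ := P.support_nonempty
  have hex : ∀ n, ∃ C : ListCode X Y n, (∃ C, good (κ n) n C) → good (κ n) n C := fun n => by
    by_cases h : ∃ C, good (κ n) n C
    · exact ⟨h.choose, fun _ => h.choose_spec⟩
    -- A dummy code for lengths without a good one; these do not affect the limits.
    · exact ⟨⟨2, 1, one_pos, one_lt_two, fun _ _ => x₀, fun _ => ∅, by simp, by simp⟩,
        fun h' => absurd h' h⟩
  choose C hC using hex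
  have hCg : ∀ᶠ n in atTop, good (κ n) n (C n) := hgood.mono fun n hn => hC n hn
  have hδ : Tendsto (fun n => 1 / ((κ n : ℝ) + 1)) atTop (𝓝 0) :=
    tendsto_one_div_add_atTop_nhds_zero_nat.comp hκ
  have hδ' : Tendsto (fun n => ENNReal.ofReal (1 / ((κ n : ℝ) + 1))) atTop (𝓝 0) := by
    simpa using ENNReal.tendsto_ofReal hδ
  refine ⟨C, fun n => 1 / ((κ n : ℝ) + 1), ⟨?_, ?_⟩, ⟨?_, ?_⟩, hδ, fun n => by positivity,
    hCg.mono fun n h => h.2.2.2.2⟩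
  · exact tendsto_of_tendsto_of_tendsto_of_le_of_le' tendsto_const_nhds hδ'
      (Eventually.of_forall fun _ => zero_le) (hCg.mono fun n h => h.2.2.1)
  · exact tendsto_of_tendsto_of_tendsto_of_le_of_le' tendsto_const_nhds hδ'
      (Eventually.of_forall fun _ => zero_le) (hCg.mono fun n h => h.2.2.2.1)
  · exact (tendsto_logb_expCard (hR₂.trans hR.le)).congr' (hCg.mono fun n h => by simp only [h.1])
  · exact (tendsto_logb_expCard hR₂).congr' (hCg.mono fun n h => by simp only [h.2.1])

/-- The limit of a normalized lower bound on the equivocation. -/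
theorem tendsto_rate_sub {l δ : ℕ → ℝ} {R a b : ℝ}
    (hl : Tendsto (fun n : ℕ => l n / n) atTop (𝓝 R)) (hδ : Tendsto δ atTop (𝓝 0)) :
    Tendsto (fun n : ℕ => (l n - n * (a + δ n * b)) / n) atTop (𝓝 (R - a)) := by
  have h : Tendsto (fun n : ℕ => l n / n - (a + δ n * b)) atTop (𝓝 (R - (a + 0 * b))) :=
    hl.sub (tendsto_const_nhds.add (hδ.mul_const b))
  rw [zero_mul, add_zero] at h
  refine h.congr' ?_
  filter_upwards [eventually_gt_atTop 0] with n hn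
  have : (n : ℝ) ≠ 0 := (Nat.cast_pos.2 hn).ne'
  field_simp

theorem stronglyDetAchievable_of_lt (hW : NonRedundant W) {P : PMF X} {R₁ R₂ R₃ : ℝ}
    (hR₂ : 0 ≤ R₂) (hR : R₂ < R₁) (hI : R₁ - R₂ < (mutualInfo W P).toReal)
    (hH : R₁ < inputEntropy P) (hR₃ : R₃ ≤ R₁ - (mutualInfo W P).toReal) :
    StronglyDetAchievable W R₁ R₂ R₃ := by
  obtain ⟨C, δ, hsec, hrates, hδ, hδ0, htyp⟩ := exists_secure_typical_codes hW hR₂ hR hI hH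
  exact ⟨C, hsec, hrates, (EReal.coe_le_coe_iff.2 hR₃).trans (le_liminf_div_of_tendsto
    (htyp.mono fun n hn => le_equivocation hn (hδ0 n)) (tendsto_rate_sub hrates.1 hδ))⟩

/-- The codes depend on neither `α` nor `Q`. For each `r < R₃` some `Q` has divergence below `R₁ -
r`, which gives the liminf bound `r`; letting `r` increase to `R₃` avoids having to attain the
minimum over `Q`. -/
theorem renyiStronglyDetAchievable_of_lt (hW : NonRedundant W) {P : PMF X} {R₁ R₂ R₃ α : ℝ}
    (hα : 1 < α) (hR₂ : 0 ≤ R₂) (hR : R₂ < R₁) (hI : R₁ - R₂ < (mutualInfo W P).toReal)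
    (hH : R₁ < inputEntropy P) (hR₃ : (R₃ : EReal) ≤ (R₁ : EReal) - renyiMutualInfo α W P) :
    RenyiStronglyDetAchievable α W R₁ R₂ R₃ := by
  obtain ⟨C, δ, hsec, hrates, hδ, -, htyp⟩ := exists_secure_typical_codes hW hR₂ hR hI hH
  refine ⟨C, hsec, hrates, le_of_forall_lt_imp_le_of_dense fun r hr => ?_⟩
  induction r with
  | bot => exact bot_le
  | top => exact absurd hr not_top_lt
  | coe r =>
    obtain ⟨Q, hQ⟩ : ∃ Q : ProbabilityMeasure Y,
        renyiDiv α (jointLaw P W) (jointLaw P fun _ => (Q : Measure Y)) <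
          ((R₁ - r : ℝ) : EReal) := by
      by_contra! hcon
      have h1 : ((R₁ - r : ℝ) : EReal) ≤ renyiMutualInfo α W P := le_iInf hcon
      have h2 := hR₃.trans (EReal.sub_le_sub le_rfl h1)
      rw [← EReal.coe_sub, sub_sub_cancel] at h2
      exact absurd hr (not_lt.2 h2)
    obtain ⟨m, hm, hac, hmom, hlt⟩ := exists_moments_of_renyiDiv_lt hα hQ
    set a := Real.log (∑ x, (P x).toReal * m x) / Real.log 2 / (α - 1) with ha
    have hlim := tendsto_rate_sub (a := a)
      (b := (∑ x, |Real.log (m x)|) / Real.log 2 / (α - 1)) hrates.1 hδ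
    refine le_trans (EReal.coe_le_coe_iff.2 (by linarith : r ≤ R₁ - a))
      (le_liminf_div_of_tendsto (htyp.mono fun n hn => ?_) hlim)
    refine le_trans (le_of_eq ?_) (le_renyiEquivocation hn hα hm hac hmom)
    rw [ha]
    congr 1
    ring

end Achievability

end SecureListDecoding

theorem mainTheorem4 {X Y : Type*} [Fintype X] [MeasurableSpace X] [MeasurableSingletonClass X]
    [MeasurableSpace Y] (W : X → Measure Y) [∀ x, IsProbabilityMeasure (W x)]
    (hW2 : SecureListDecoding.NonRedundant W) :
    (∀ R₁ R₂ R₃ : ℝ, 0 ≤ R₂ →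
      (∃ P : PMF X,
        0 < R₁ - R₂ ∧
        ((R₁ - R₂ : ℝ) : EReal) < (SecureListDecoding.mutualInfo W P : EReal) ∧
        R₁ < SecureListDecoding.inputEntropy P ∧
        (R₃ : EReal) ≤ (R₁ : EReal) - (SecureListDecoding.mutualInfo W P : EReal)) →
      SecureListDecoding.StronglyDetAchievable W R₁ R₂ R₃) ∧
    (∀ α : ℝ, 1 < α → ∀ R₁ R₂ R₃ : ℝ, 0 ≤ R₂ →
      (∃ P : PMF X,
        0 < R₁ - R₂ ∧
        ((R₁ - R₂ : ℝ) : EReal) < (SecureListDecoding.mutualInfo W P : EReal) ∧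
        R₁ < SecureListDecoding.inputEntropy P ∧
        (R₃ : EReal) ≤ (R₁ : EReal) - SecureListDecoding.renyiMutualInfo α W P) →
      SecureListDecoding.RenyiStronglyDetAchievable α W R₁ R₂ R₃) := by 
  classical
  have hlt : ∀ {P : PMF X} {s : ℝ}, (s : EReal) < (SecureListDecoding.mutualInfo W P : EReal) →
      s < (SecureListDecoding.mutualInfo W P).toReal := fun {P s} h => by
    rwa [← EReal.coe_ennreal_toReal (SecureListDecoding.mutualInfo_ne_top W P),
      EReal.coe_lt_coe_iff] at h
  refine ⟨fun R₁ R₂ R₃ hR₂ ⟨P, hR, hI, hH, hR₃⟩ => ?_,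
    fun α hα R₁ R₂ R₃ hR₂ ⟨P, hR, hI, hH, hR₃⟩ => ?_⟩
  · refine SecureListDecoding.stronglyDetAchievable_of_lt hW2 hR₂ (sub_pos.1 hR) (hlt hI) hH ?_
    rw [← EReal.coe_ennreal_toReal (SecureListDecoding.mutualInfo_ne_top W P)] at hR₃
    exact_mod_cast hR₃
  · exact SecureListDecoding.renyiStronglyDetAchievable_of_lt hW2 hα hR₂ (sub_pos.1 hR) (hlt hI)
      hH hR₃
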